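/- Let $d\ge 2$, $\omega=e^{2\pi i/d}$, and let $W_{nm}=\sum_{k=0}^{d-1}\omega^{kn}\,|k\rangle\langle k+m \bmod d|$, $0\le n,m\le d-1$, be the discrete Weyl operators on $\mathbb C^d$. Let $p=(p_{nm})$ be a probability vector with $d^2$ entries and let $\mathcal N(\rho)=\sum_{n,m}p_{nm}W_{nm}\rho W_{nm}^\dagger$ be the corresponding discrete Weyl channel. Let $H$ and $S$ denote the Shannon and the von Neumann entropy, with logarithms to base $2$. Consider the following bounds on the Holevo capacity of $\mathcal N$. * Lower bound for prime $d$: $L(p)=\log_2 d-\min_{(n,m)\ne(0,0)}H(\text{row of }T_{nm})$, where $T_{nm}$ is the circulant $d\times d$ matrix with first row $(P_1,\dots,P_d)$, $P_k=\sum_{(i,j):\,\omega^{mi-nj}=\omega^{k-1}}p_{ij}$ (the transition matrix obtained by using the eigenstates of $W_{nm}$ as signal states). * Lower bound for arbitrary $d$: $L'(p)=\log_2 d-\min S(\mathcal N(|\lambda\rangle\langle\lambda|))$, where the minimum is over all unit eigenvectors $|\lambda\rangle$ of all $W_{nm}$ with $(n,m)\neq(0,0)$. * Upper bound: $U(p)=\log_2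 d-H(\zeta(p))$, where $\zeta(p)\in\mathbb R^d$ is obtained by sorting the entries of $p$ in nonincreasing order and summing consecutive groups of $d$ entries. A $d$-set is a family $\mathcal D_0,\dots,\mathcal D_{d-1}$ of pairwise disjoint $d$-element sets of index pairs $(i,j)\in\{0,\dots,d-1\}^2$. It is achievable if there are $(n,m)\ne(0,0)$ and constants $k_0,\dots,k_{d-1}$ (not necessarily distinct) such that $mi-nj \bmod d=k_l$ for all $(i,j)\in\mathcal D_l$ and all $l$. Arrange the index pairs so that the $p_{nm}$ are nonincreasing, and let consecutive groups of $d$ index pairs form a $d$-set. Say that $p$ satisfies condition (A) if this $d$-set is achievable, where ties among the $p_{nm}$ may be ordered at will (that is, it is achievable for at least one nonincreasing arrangement). Then: 1. If $d$ is prime, then for every $p$: $L(p)=U(p)$ if and only if (A) holds, and likewise $L'(p)=U(p)$ if and only if (A) holds. 2. If $d$ is composite, then $L'(p)=U(p)$ implies (A) for every $p$, but (A) is not sufficient: for every composite $d$ there is a $p$ that satisfies (A) with $L'(p)\ne U(p)$. -/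

import Mathlib

namespace WeylChannel

open scoped Matrix

noncomputable section

/-- Index pairs `(n, m)` of the `d ^ 2` discrete Weyl operators. -/
abbrev Idx (d : ℕ) : Type := ZMod d × ZMod d

variable {d : ℕ} [NeZero d]

/-- The primitive root of unity `ω = exp (2 π i / d)`. -/
def omega (d : ℕ) : ℂ := Complex.exp (2 * Real.pi * Complex.I / d)

/-- The discrete Weyl operator `W_{nm} = ∑ₖ ω ^ (k n) |k⟩⟨k + m mod d|`, with `a = (n, m)`. -/
def weyl (a : Idx d) : Matrix (ZMod d) (ZMod d) ℂ :=
  ∑ k : ZMod d, omega d ^ (k.val * a.1.val) • Matrix.single k (k + a.2) 1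

/-- The discrete Weyl channel `ρ ↦ ∑_{nm} p_{nm} W_{nm} ρ W_{nm}†`. -/
def channel (p : Idx d → ℝ) (ρ : Matrix (ZMod d) (ZMod d) ℂ) : Matrix (ZMod d) (ZMod d) ℂ :=
  ∑ a : Idx d, (p a : ℂ) • (weyl a * ρ * (weyl a)ᴴ)

/-- `p` is a probability vector. -/
def IsProb (p : Idx d → ℝ) : Prop := (∀ a, 0 ≤ p a) ∧ ∑ a, p a = 1

/-- Shannon entropy, in bits (with `0 log 0 = 0`). -/
def shannon {ι : Type} [Fintype ι] (v : ι → ℝ) : ℝ := -∑ i, v i * Real.logb 2 (v i)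

/-- Von Neumann entropy `S(ρ) = -Tr (ρ log₂ ρ)`, in bits (with `0 log 0 = 0`). -/
def vonNeumann (ρ : Matrix (ZMod d) (ZMod d) ℂ) : ℝ :=
  -(ρ * cfc (Real.logb 2) ρ).trace.re

/-- The symplectic expression `m i - n j mod d` for `a = (n, m)` and `b = (i, j)`. -/
def symp (a b : Idx d) : ZMod d := a.2 * b.1 - a.1 * b.2

/-- `P_{k+1} = ∑ p_{ij}`, over all `(i, j)` with `m i - n j = k mod d`, where `a = (n, m)`. -/
def transProb (p : Idx d → ℝ) (a : Idx d) (k : ZMod d) : ℝ :=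
  ∑ b : Idx d with symp a b = k, p b

/-- The circulant transition matrix `T_{nm}` with first row `P_1, …, P_d`. -/
def transMatrix (p : Idx d → ℝ) (a : Idx d) : Matrix (ZMod d) (ZMod d) ℝ :=
  Matrix.of fun x y => transProb p a (y - x)

/-- The lower bound `log₂ d - min_{(n,m) ≠ (0,0)} H(row of T_{nm})`.
All rows of `T_{nm}` are permutations of each other; the row with index `0` is used. -/
def lowerBound (p : Idx d → ℝ) : ℝ :=
  Real.logb 2 d - ⨅ a : {a : Idx d // a ≠ 0}, shannon (transMatrix p a.1 0)

/-- `ψ` is a unit eigenvector of `W_{nm}`, where `a = (n, m)`. -/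
def IsEigenstate (a : Idx d) (ψ : ZMod d → ℂ) : Prop :=
  star ψ ⬝ᵥ ψ = 1 ∧ ∃ μ : ℂ, weyl a *ᵥ ψ = μ • ψ

/-- The pure state `|ψ⟩⟨ψ|`. -/
def pureState (ψ : ZMod d → ℂ) : Matrix (ZMod d) (ZMod d) ℂ := Matrix.vecMulVec ψ (star ψ)

/-- The lower bound `log₂ d - min S(N(|ψ⟩⟨ψ|))`, the minimum being over all eigenstates `ψ`
of all Weyl operators `W_{nm}` with `(n, m) ≠ (0, 0)`. -/
def eigenLowerBound (p : Idx d → ℝ) : ℝ :=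
  Real.logb 2 d - sInf {s : ℝ | ∃ a : Idx d, a ≠ 0 ∧ ∃ ψ : ZMod d → ℂ,
    IsEigenstate a ψ ∧ s = vonNeumann (channel p (pureState ψ))}

/-- The vector `p = [p₀₀, p₀₁, …]` with `d ^ 2` entries. -/
def vec (p : Idx d → ℝ) : Fin (d * d) → ℝ := fun r =>
  p (((finProdFinEquiv.symm r).1.val : ZMod d), ((finProdFinEquiv.symm r).2.val : ZMod d))

/-- The entries of `p` in descending order. -/
def descending (p : Idx d → ℝ) : Fin (d * d) → ℝ :=
  vec p ∘ Tuple.sort (fun r => OrderDual.toDual (vec p r))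

/-- The `d × d²` matrix whose `i`-th row is `1` exactly in the `i`-th group of `d` columns. -/
def groupMatrix (d : ℕ) : Matrix (Fin d) (Fin (d * d)) ℝ :=
  Matrix.of fun i r => if r.val / d = i.val then 1 else 0

/-- `ζ(p) = S p↓`: sums of the consecutive groups of `d` entries of the sorted vector. -/
def zeta (p : Idx d → ℝ) : Fin d → ℝ := groupMatrix d *ᵥ descending p

/-- The upper bound `log₂ d - H(ζ(p))`. -/
def upperBound (p : Idx d → ℝ) : ℝ := Real.logb 2 d - shannon (zeta p)

/-- A `d`-set: `d` pairwise disjoint `d`-element sets of index pairs. -/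
structure DSet (d : ℕ) where
  block : Fin d → Finset (Idx d)
  card_block : ∀ i, (block i).card = d
  disjoint_block : ∀ i j, i ≠ j → Disjoint (block i) (block j)

/-- A `d`-set is achievable if, for some `(n, m) ≠ (0, 0)`, the expression `m i - n j mod d` is
constant on each of its blocks. -/
def DSet.Achievable (D : DSet d) : Prop :=
  ∃ a : Idx d, a ≠ 0 ∧ ∃ k : Fin d → ZMod d, ∀ i, ∀ b ∈ D.block i, symp a b = k i

/-- The `d`-set formed from an arrangement of all index pairs by taking consecutive groups of
`d` of them: block `i` consists of the positions `d i, …, d i + d - 1`. -/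
def groupArrangement (σ : Fin (d * d) ≃ Idx d) : DSet d where
  block i := Finset.univ.image fun r : Fin d => σ (finProdFinEquiv (i, r))
  card_block i := by
    rw [Finset.card_image_of_injective]
    · simp
    · intro r s h
      simpa using h
  disjoint_block i j hij := by
    rw [Finset.disjoint_left]
    intro b hb hb'
    simp only [Finset.mem_image, Finset.mem_univ, true_and] at hb hb'
    obtain ⟨r, rfl⟩ := hb
    obtain ⟨s, h⟩ := hb'
    simp only [EmbeddingLike.apply_eq_iff_eq, Prod.mk.injEq] at h
    exact hij h.1.symm

/-- Some arrangement of the index pairs with `p` nonincreasing yields an achievable `d`-set.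
(The arrangement is unique unless `p` has ties, which may be ordered at will.) -/
def SortedAchievable (p : Idx d → ℝ) : Prop :=
  ∃ σ : Fin (d * d) ≃ Idx d, Antitone (fun r => p (σ r)) ∧ (groupArrangement σ).Achievable

end

end WeylChannel

/-!
Write `S` for the output entropy of an eigenstate `ψ` of a Weyl operator `W_a`, `a ≠ 0`. The proof
reduces everything to arrangements of the `d ^ 2` index pairs into `d` blocks of size `d` and the
Shannon entropies of their block sums.

*Majorization.* Among all arrangements the nonincreasing one has the largest partial block sums, so
its block sums `ζ(p)` majorize all others and `H(ζ(p))` is the smallest entropy (`shannon_zeta_le`).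
By strict Schur concavity (`shannon_le_of_majorize`) an arrangement attaining it has the same block
sums as the sorted one up to order, and the equality case of the rearrangement inequality shows that
it is sorted up to the order inside the blocks (`sortedAchievable_of_shannon_le`).

*Eigenstates.* The channel output at `ψ` is a mixture of the eigenvectors `W_b ψ` of `W_a`, whose
eigenvalues are given by `symp a b`. It commutes with `W_a`, and in a joint eigenbasis `φ_l` its
eigenvalues are `∑_b p_b |⟨φ_l, W_b ψ⟩|²`, where the overlaps form `d` times a doubly stochastic
array supported where `symp a b` has the value belonging to `φ_l` (`exists_overlaps`). By
Birkhoff's theorem and concavity, `S` is at least the entropy of the block sums of some arrangement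
with `symp a` constant on each block (`exists_arrangement_of_isEigenstate`). As there are finitely
many of these, equality of the bounds forces one of them to attain `H(ζ(p))`, hence
`SortedAchievable p`, for every `d`.

*Prime `d`.* All values of `symp a` occur, so the `d` eigenvectors `φ_l` belong to distinct values
and the overlaps are indicators of the fibres of `symp a`. Hence `S` is the Shannon entropy of the
transition probabilities (`vonNeumann_eq_shannon_transProb`), both lower bounds agree, and a sorted
achievable arrangement has the fibres as its blocks, so that `S = H(ζ(p))` is attained.

*Composite `d = m n`.* For the uniform distribution on `(0, 0)`, `(0, 1)` and `(m, 0)`, all three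
in the kernel of `symp (0, n)`, `SortedAchievable` holds and `H(ζ(p)) = 0`. But `W_{01}` and
`W_{m0}` do not commute, hence have no common eigenvector, so that no output is pure
(`impurity_pos`), and by compactness the output entropies are bounded away from `0`.
-/

namespace WeylChannel

open scoped Matrix

noncomputable section

set_option linter.unusedSectionVars false

variable {d : ℕ} [NeZero d]

/-! ### Majorization and Shannon entropy -/

/-- The form of Abel summation that admits a direct induction on the length. -/
lemma sum_mul_last_le_sum_mul_of_antitone {n : ℕ} (z c : Fin (n + 1) → ℝ) (hc : Antitone c)
    (hz : ∀ j : ℕ, 0 ≤ ∑ i, if i.val < j then z i else 0) :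
    (∑ i, z i) * c (Fin.last n) ≤ ∑ i, z i * c i := by
  induction n with
  | zero => simp
  | succ n ih =>
    have h := ih (fun i => z i.castSucc) (fun i => c i.castSucc)
      (fun i j hij => hc (by simpa using hij)) (fun j => by
        have h := hz (min j (n + 1))
        rw [Fin.sum_univ_castSucc] at h
        simpa [Fin.is_le] using h)
    have h0 : 0 ≤ ∑ i : Fin (n + 1), z i.castSucc := by
      have h := hz (n + 1)
      rw [Fin.sum_univ_castSucc] at h
      simpa [Fin.is_le] using h
    rw [Fin.sum_univ_castSucc, Fin.sum_univ_castSucc (fun i => z i * c i)]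
    have hle : c (Fin.last (n + 1)) ≤ c (Fin.last n).castSucc := hc (Fin.le_last _)
    nlinarith [mul_le_mul_of_nonneg_left hle h0]

/-- **Abel summation**: a sequence with nonnegative partial sums and total zero pairs nonnegatively
with a nonincreasing one. -/
lemma sum_mul_nonneg_of_antitone {n : ℕ} (z c : Fin n → ℝ) (hc : Antitone c)
    (hz : ∀ j : ℕ, 0 ≤ ∑ i, if i.val < j then z i else 0) (h0 : ∑ i, z i = 0) :
    0 ≤ ∑ i, z i * c i := by
  cases n with
  | zero => simp
  | succ n => simpa [h0] using sum_mul_last_le_sum_mul_of_antitone z c hc hz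

/-- The convex function `t ↦ t log t` lies strictly above its tangent line at `y`. -/
lemma tangent_lt_mul_log {x y : ℝ} (hx : 0 ≤ x) (hy : 0 < y) (hxy : x ≠ y) :
    y * Real.log y + (x - y) * (Real.log y + 1) < x * Real.log x := by
  rcases hx.eq_or_lt with rfl | hx
  · simp; linarith
  · have h := Real.log_lt_sub_one_of_pos (x := y / x) (by positivity)
      (fun h => hxy (by field_simp at h; exact h.symm))
    rw [Real.log_div hy.ne' hx.ne'] at h
    have h2 := mul_lt_mul_of_pos_left h hx
    have h3 : x * (y / x - 1) = y - x := by field_simp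
    nlinarith

lemma shannon_eq_log {ι : Type} [Fintype ι] (v : ι → ℝ) :
    shannon v = -(∑ i, v i * Real.log (v i)) / Real.log 2 := by
  simp only [shannon, Real.logb, neg_div, Finset.sum_div, mul_div_assoc]

lemma shannon_comp_equiv {ι κ : Type} [Fintype ι] [Fintype κ] (e : ι ≃ κ) (v : κ → ℝ) :
    shannon (fun i => v (e i)) = shannon v := by
  simp only [shannon, e.sum_comp fun k => v k * Real.logb 2 (v k)]

/-- Strict Schur concavity of the Shannon entropy: if the partial sums of `x` dominate those of the
nonincreasing vector `y`, and the totals agree, then `H(x) ≤ H(y)`, with equality only for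
`x = y`. -/
lemma shannon_le_of_majorize {n : ℕ} {x y : Fin n → ℝ} (hx : ∀ i, 0 ≤ x i) (hy : ∀ i, 0 ≤ y i)
    (hanti : Antitone y)
    (hps : ∀ j : ℕ, (∑ i, if i.val < j then y i else 0) ≤ ∑ i, if i.val < j then x i else 0)
    (htot : ∑ i, y i = ∑ i, x i) :
    shannon x ≤ shannon y ∧ (shannon y ≤ shannon x → x = y) := by
  -- `c` extends `log ∘ y` by a very negative value at the zeros of `y`, where `log 0 = 0` is junk.
  set M : ℝ := ∑ i, |Real.log (x i)| + ∑ i, |Real.log (y i)| + 2 with hM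
  set c : Fin n → ℝ := fun i => if y i = 0 then -M else Real.log (y i) with hcdef
  have hMx : ∀ i, |Real.log (x i)| + 2 ≤ M := fun i => by
    have h1 := Finset.single_le_sum (f := fun i => |Real.log (x i)|) (fun i _ => abs_nonneg _)
      (Finset.mem_univ i)
    have h2 : 0 ≤ ∑ i, |Real.log (y i)| := Finset.sum_nonneg fun i _ => abs_nonneg _
    linarith
  have hMy : ∀ i, |Real.log (y i)| ≤ M := fun i => by
    have h1 := Finset.single_le_sum (f := fun i => |Real.log (y i)|) (fun i _ => abs_nonneg _)
      (Finset.mem_univ i)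
    have h2 : 0 ≤ ∑ i, |Real.log (x i)| := Finset.sum_nonneg fun i _ => abs_nonneg _
    linarith
  have hc : Antitone c := fun i j hij => by
    simp only [hcdef]
    have hle := hanti hij
    split_ifs with hj hi hi
    · exact le_rfl
    · linarith [neg_abs_le (Real.log (y i)), hMy i]
    · exact absurd (le_antisymm (hle.trans hi.le) (hy j)) hj
    · exact Real.log_le_log (lt_of_le_of_ne (hy j) (Ne.symm hj)) hle
  have hpt : ∀ i, x i ≠ y i →
      y i * Real.log (y i) + (x i - y i) * (c i + 1) < x i * Real.log (x i) := fun i hi => by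
    simp only [hcdef]
    split_ifs with h
    · rw [h] at hi ⊢
      have hpos : 0 < x i := lt_of_le_of_ne (hx i) (Ne.symm hi)
      have h1 : -M + 1 < Real.log (x i) := by linarith [neg_abs_le (Real.log (x i)), hMx i]
      have := mul_lt_mul_of_pos_left h1 hpos
      simpa using this
    · exact tangent_lt_mul_log (hx i) (lt_of_le_of_ne (hy i) (Ne.symm h)) hi
  have hpt' : ∀ i, y i * Real.log (y i) + (x i - y i) * (c i + 1) ≤ x i * Real.log (x i) := by
    intro i
    by_cases hi : x i = y i
    · simp [hi]
    · exact (hpt i hi).le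
  have h0 : ∑ i, (x i - y i) = 0 := by rw [Finset.sum_sub_distrib, htot, sub_self]
  have habel : 0 ≤ ∑ i, (x i - y i) * c i := by
    refine sum_mul_nonneg_of_antitone _ c hc (fun j => ?_) h0
    have h := sub_nonneg.2 (hps j)
    rw [← Finset.sum_sub_distrib] at h
    refine h.trans_eq (Finset.sum_congr rfl fun i _ => ?_)
    split_ifs <;> simp
  have hsplit : ∑ i, (y i * Real.log (y i) + (x i - y i) * (c i + 1)) =
      ∑ i, y i * Real.log (y i) + ∑ i, (x i - y i) * c i := by
    simp only [Finset.sum_add_distrib, mul_add, mul_one, h0, add_zero]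
  have hlog : 0 < Real.log 2 := Real.log_pos (by norm_num)
  rw [shannon_eq_log, shannon_eq_log, div_le_div_iff_of_pos_right hlog,
    div_le_div_iff_of_pos_right hlog, neg_le_neg_iff, neg_le_neg_iff]
  constructor
  · have := Finset.sum_le_sum fun i (_ : i ∈ Finset.univ) => hpt' i
    linarith
  · intro hle
    by_contra hne
    obtain ⟨i, hi⟩ := Function.ne_iff.1 hne
    have := Finset.sum_lt_sum (fun i (_ : i ∈ Finset.univ) => hpt' i)
      ⟨i, Finset.mem_univ i, hpt i hi⟩
    linarith

/-! ### Arrangements of the index pairs and their block sums -/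

/-- The sums of `p` over the consecutive groups of `d` index pairs in the arrangement `σ`. -/
def blockSum (p : Idx d → ℝ) (σ : Fin (d * d) ≃ Idx d) (i : Fin d) : ℝ :=
  ∑ r : Fin d, p (σ (finProdFinEquiv (i, r)))

lemma finProdFinEquiv_val_div (i r : Fin d) : (finProdFinEquiv (i, r)).val / d = i.val := by
  have hd : 0 < d := Nat.pos_of_ne_zero (NeZero.ne d)
  simp [finProdFinEquiv_apply_val, Nat.add_mul_div_left _ _ hd, Nat.div_eq_of_lt r.isLt]

lemma sum_finProdFinEquiv (f : Fin (d * d) → ℝ) :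
    ∑ t, f t = ∑ i : Fin d, ∑ r : Fin d, f (finProdFinEquiv (i, r)) := by
  rw [← finProdFinEquiv.sum_comp, Fintype.sum_prod_type]

lemma exists_finEquivZMod (d : ℕ) [NeZero d] :
    ∃ e : Fin d ≃ ZMod d, ∀ i, e i = ((i.val : ℕ) : ZMod d) := by
  have hbij : Function.Bijective (fun i : Fin d => ((i.val : ℕ) : ZMod d)) := by
    rw [Fintype.bijective_iff_injective_and_card]
    refine ⟨fun i j h => ?_, by simp [ZMod.card]⟩
    have := congrArg ZMod.val h
    simp only [ZMod.val_natCast, Nat.mod_eq_of_lt i.isLt, Nat.mod_eq_of_lt j.isLt] at this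
    exact Fin.ext this
  exact ⟨Equiv.ofBijective _ hbij, fun i => rfl⟩

/-- The enumeration of the index pairs that underlies `vec`. -/
lemma exists_vec_equiv (d : ℕ) [NeZero d] :
    ∃ e : Fin (d * d) ≃ Idx d, ∀ p : Idx d → ℝ, vec p = fun r => p (e r) := by
  obtain ⟨e, he⟩ := exists_finEquivZMod d
  exact ⟨finProdFinEquiv.symm.trans (Equiv.prodCongr e e), fun p => by
    funext r
    simp [vec, he]⟩

/-- `ζ(p)` is the vector of block sums of a nonincreasing arrangement. -/
lemma exists_antitone_zeta_eq (p : Idx d → ℝ) :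
    ∃ τ : Fin (d * d) ≃ Idx d, Antitone (fun r => p (τ r)) ∧ zeta p = blockSum p τ := by
  obtain ⟨e, he⟩ := exists_vec_equiv d
  refine ⟨(Tuple.sort fun r => OrderDual.toDual (vec p r)).trans e, ?_, ?_⟩
  · have h := Tuple.monotone_sort (fun r => OrderDual.toDual (vec p r))
    intro r s hrs
    have := h hrs
    simpa [he] using this
  · funext i
    simp only [zeta, Matrix.mulVec, dotProduct, groupMatrix, Matrix.of_apply, blockSum]
    rw [sum_finProdFinEquiv, Finset.sum_eq_single i]
    · refine Finset.sum_congr rfl fun r _ => ?_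
      rw [if_pos (finProdFinEquiv_val_div i r), one_mul, descending, Function.comp_apply]
      simp only [he, Equiv.trans_apply]
    · intro j _ hj
      refine Finset.sum_eq_zero fun r _ => ?_
      rw [if_neg, zero_mul]
      rw [finProdFinEquiv_val_div]
      exact fun h => hj (Fin.ext h)
    · simp

lemma sum_blockSum (p : Idx d → ℝ) (σ : Fin (d * d) ≃ Idx d) :
    ∑ i, blockSum p σ i = ∑ b, p b := by
  rw [← σ.sum_comp, sum_finProdFinEquiv]; rfl

lemma blockSum_nonneg {p : Idx d → ℝ} (hp : ∀ b, 0 ≤ p b) (σ : Fin (d * d) ≃ Idx d) (i : Fin d) :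
    0 ≤ blockSum p σ i := Finset.sum_nonneg fun _ _ => hp _

/-- The indicator of the positions in the first `j` blocks. -/
def firstBlocks (d j : ℕ) (t : Fin (d * d)) : ℝ := if t.val / d < j then 1 else 0

lemma antitone_firstBlocks (j : ℕ) : Antitone (firstBlocks d j) := by
  intro s t hst
  have h : s.val / d ≤ t.val / d := Nat.div_le_div_right hst
  simp only [firstBlocks]
  split_ifs <;> first | omega | norm_num

lemma partial_blockSum (p : Idx d → ℝ) (σ : Fin (d * d) ≃ Idx d) (j : ℕ) :
    (∑ i : Fin d, if i.val < j then blockSum p σ i else 0) =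
      ∑ t, firstBlocks d j t * p (σ t) := by
  rw [sum_finProdFinEquiv]
  refine Finset.sum_congr rfl fun i _ => ?_
  simp only [firstBlocks, finProdFinEquiv_val_div, blockSum]
  split_ifs <;> simp

/-- Permute the blocks of the arrangement `σ` by `ρ`, and the entries of block `i` by `π i`. -/
def rearrange (σ : Fin (d * d) ≃ Idx d) (ρ : Equiv.Perm (Fin d)) (π : Fin d → Equiv.Perm (Fin d)) :
    Fin (d * d) ≃ Idx d :=
  (finProdFinEquiv.symm.trans ((Equiv.prodShear ρ π).trans finProdFinEquiv)).trans σ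

lemma rearrange_apply (σ : Fin (d * d) ≃ Idx d) (ρ : Equiv.Perm (Fin d))
    (π : Fin d → Equiv.Perm (Fin d)) (i r : Fin d) :
    rearrange σ ρ π (finProdFinEquiv (i, r)) = σ (finProdFinEquiv (ρ i, π i r)) := by
  simp [rearrange]

lemma exists_antitone_blockSum (p : Idx d → ℝ) (σ : Fin (d * d) ≃ Idx d) :
    ∃ ρ : Equiv.Perm (Fin d), Antitone (blockSum p (rearrange σ ρ fun _ => 1)) ∧
      blockSum p (rearrange σ ρ fun _ => 1) = fun i => blockSum p σ (ρ i) := by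
  have heq : ∀ ρ, blockSum p (rearrange σ ρ fun _ => 1) = fun i => blockSum p σ (ρ i) := by
    intro ρ
    funext i
    simp [blockSum, rearrange_apply]
  refine ⟨Tuple.sort fun i => OrderDual.toDual (blockSum p σ i), ?_, heq _⟩
  rw [heq]
  intro i j hij
  exact Tuple.monotone_sort (fun i => OrderDual.toDual (blockSum p σ i)) hij

lemma partial_blockSum_le {p : Idx d → ℝ} {τ : Fin (d * d) ≃ Idx d}
    (hτ : Antitone fun r => p (τ r)) (σ : Fin (d * d) ≃ Idx d) (j : ℕ) :
    (∑ i : Fin d, if i.val < j then blockSum p σ i else 0) ≤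
      ∑ i : Fin d, if i.val < j then blockSum p τ i else 0 := by
  rw [partial_blockSum, partial_blockSum]
  have h := ((antitone_firstBlocks (d := d) j).monovary hτ).sum_mul_comp_perm_le_sum_mul
    (σ := σ.trans τ.symm)
  simpa using h

/-- The sorted block sums majorize those of any other arrangement. -/
lemma shannon_zeta_le {p : Idx d → ℝ} (hp : ∀ b, 0 ≤ p b) (σ : Fin (d * d) ≃ Idx d) :
    shannon (zeta p) ≤ shannon (blockSum p σ) := by
  obtain ⟨τ, hτ, hz⟩ := exists_antitone_zeta_eq p
  obtain ⟨ρ, hanti, hρ⟩ := exists_antitone_blockSum p σ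
  have h := (shannon_le_of_majorize (blockSum_nonneg hp τ) (blockSum_nonneg hp _) hanti
    (partial_blockSum_le hτ _) (by rw [sum_blockSum, sum_blockSum])).1
  rwa [hρ, shannon_comp_equiv, ← hz] at h

/-- `ζ(p)` does not depend on how ties are broken. -/
lemma zeta_eq_of_antitone {p : Idx d → ℝ} {σ : Fin (d * d) ≃ Idx d}
    (hσ : Antitone fun r => p (σ r)) : zeta p = blockSum p σ := by
  obtain ⟨τ, hτ, hz⟩ := exists_antitone_zeta_eq p
  rw [hz]
  have hfun : (fun r => p (τ r)) = fun r => p (σ r) := by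
    have h := Tuple.unique_monotone (f := fun r => OrderDual.toDual (p (σ r)))
      (σ := τ.trans σ.symm) (τ := 1) (fun r s hrs => by simpa using hτ hrs)
      (fun r s hrs => by simpa using hσ hrs)
    funext r
    have := congrFun h r
    simpa using this
  funext i
  exact Finset.sum_congr rfl fun r _ => congrFun hfun _

/-- It suffices that the arrangement is sorted up to the order within each block. -/
lemma sortedAchievable_of_blocks {p : Idx d → ℝ} {a : Idx d} (ha : a ≠ 0)
    (σ : Fin (d * d) ≃ Idx d) (k : Fin d → ZMod d)
    (hk : ∀ i r, symp a (σ (finProdFinEquiv (i, r))) = k i)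
    (hs : ∀ i j r s, p (σ (finProdFinEquiv (i, r))) < p (σ (finProdFinEquiv (j, s))) → j ≤ i) :
    SortedAchievable p := by
  refine ⟨rearrange σ 1 fun i => Tuple.sort fun r =>
    OrderDual.toDual (p (σ (finProdFinEquiv (i, r)))), ?_, a, ha, k, ?_⟩
  · intro t t' htt
    obtain ⟨⟨i, r⟩, rfl⟩ := finProdFinEquiv.surjective t
    obtain ⟨⟨j, s⟩, rfl⟩ := finProdFinEquiv.surjective t'
    have hij : i ≤ j := by
      rw [Fin.le_def, ← finProdFinEquiv_val_div i r, ← finProdFinEquiv_val_div j s]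
      exact Nat.div_le_div_right htt
    simp only [rearrange_apply, Equiv.Perm.coe_one, id]
    rcases hij.lt_or_eq with hlt | rfl
    · by_contra! hcon
      exact absurd (hs _ _ _ _ hcon) (not_le.2 hlt)
    · refine Tuple.monotone_sort (fun r => OrderDual.toDual (p (σ (finProdFinEquiv (i, r))))) ?_
      rw [Fin.le_def] at htt ⊢
      simp only [finProdFinEquiv_apply_val] at htt
      omega
  · intro i b hb
    simp only [groupArrangement, Finset.mem_image, Finset.mem_univ, true_and] at hb
    obtain ⟨r, rfl⟩ := hb
    rw [rearrange_apply, hk]; rfl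

/-- Equality in the rearrangement inequality, for every number of leading blocks, forces the blocks
to be sorted. -/
lemma sortedAchievable_of_shannon_le {p : Idx d → ℝ} (hp : ∀ b, 0 ≤ p b) {a : Idx d} (ha : a ≠ 0)
    (σ : Fin (d * d) ≃ Idx d) (k : Fin d → ZMod d)
    (hk : ∀ i r, symp a (σ (finProdFinEquiv (i, r))) = k i)
    (hle : shannon (blockSum p σ) ≤ shannon (zeta p)) : SortedAchievable p := by
  obtain ⟨τ, hτ, hz⟩ := exists_antitone_zeta_eq p
  obtain ⟨ρ, hanti, hρ⟩ := exists_antitone_blockSum p σ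
  have h := (shannon_le_of_majorize (blockSum_nonneg hp τ) (blockSum_nonneg hp _) hanti
    (partial_blockSum_le hτ _) (by rw [sum_blockSum, sum_blockSum])).2
    (by rwa [hρ, shannon_comp_equiv, ← hz])
  set σ' := rearrange σ ρ fun _ => 1 with hσ'
  refine sortedAchievable_of_blocks ha σ' (fun i => k (ρ i))
    (fun i r => by rw [hσ', rearrange_apply, hk]) (fun i j r s hlt => ?_)
  have hmono : Monovary (firstBlocks d (i.val + 1)) ((fun r => p (τ r)) ∘ (σ'.trans τ.symm)) := by
    rw [← ((antitone_firstBlocks (d := d) (i.val + 1)).monovary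
      hτ).sum_mul_comp_perm_eq_sum_mul_iff]
    have := partial_blockSum p σ' (i.val + 1)
    rw [← h, partial_blockSum] at this
    simpa using this.symm
  have h1 := hmono (i := finProdFinEquiv (i, r)) (j := finProdFinEquiv (j, s)) (by simpa using hlt)
  simp only [firstBlocks, finProdFinEquiv_val_div] at h1
  by_contra! hij
  rw [if_pos (by omega), if_neg (by rw [Fin.lt_def] at hij; omega)] at h1
  norm_num at h1

/-- For prime `d` the symplectic form takes every value. -/
lemma symp_surjective (hd : d.Prime) {a : Idx d} (ha : a ≠ 0) (c : ZMod d) : ∃ b, symp a b = c := by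
  have := Fact.mk hd
  by_cases h : a.2 = 0
  · have h1 : a.1 ≠ 0 := fun h1 => ha (Prod.ext h1 h)
    exact ⟨(0, -(a.1⁻¹ * c)), by simp [symp, mul_inv_cancel_left₀ h1]⟩
  · exact ⟨(a.2⁻¹ * c, 0), by simp [symp, mul_inv_cancel_left₀ h]⟩

/-- For prime `d`, blocks on which the symplectic form is constant are exactly its fibres, so their
sums are the transition probabilities. -/
lemma shannon_blockSum_eq_transProb (hd : d.Prime) (p : Idx d → ℝ) {a : Idx d} (ha : a ≠ 0)
    (σ : Fin (d * d) ≃ Idx d) (k : Fin d → ZMod d)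
    (hk : ∀ i r, symp a (σ (finProdFinEquiv (i, r))) = k i) :
    shannon (blockSum p σ) = shannon (transProb p a) := by
  have hsurj : Function.Surjective k := fun c => by
    obtain ⟨b, hb⟩ := symp_surjective hd ha c
    obtain ⟨t, rfl⟩ := σ.surjective b
    obtain ⟨⟨i, r⟩, rfl⟩ := finProdFinEquiv.surjective t
    exact ⟨i, by rw [← hk i r, hb]⟩
  have hbij : Function.Bijective k :=
    (Fintype.bijective_iff_surjective_and_card k).2 ⟨hsurj, by simp [ZMod.card]⟩
  rw [← shannon_comp_equiv (Equiv.ofBijective k hbij)]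
  congr 1
  funext i
  rw [Equiv.ofBijective_apply, transProb, Finset.sum_filter, ← σ.sum_comp, sum_finProdFinEquiv,
    Finset.sum_eq_single i]
  · simp [hk, blockSum]
  · intro j _ hj
    exact Finset.sum_eq_zero fun r _ => by rw [hk, if_neg (fun h => hj (hbij.1 h))]
  · simp

lemma shannon_transMatrix (p : Idx d → ℝ) (a : Idx d) :
    shannon (transMatrix p a 0) = shannon (transProb p a) := by
  congr 1
  funext y
  simp [transMatrix]

/-! ### Simultaneous diagonalization and the von Neumann entropy -/

section Diagonalization

variable {n : Type} [Fintype n] [DecidableEq n]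

/-- A Hermitian matrix and a normal matrix commuting with it have a common orthonormal eigenbasis,
the columns of a unitary matrix `V`. -/
lemma exists_unitary_diagonalizing {ρ W : Matrix n n ℂ} (hρ : ρ.IsHermitian) (hW : Commute W Wᴴ)
    (hρW : Commute ρ W) :
    ∃ (V : Matrix n n ℂ) (lam : n → ℝ) (ν : n → ℂ), Vᴴ * V = 1 ∧
      ρ * V = V * Matrix.diagonal (fun l => (lam l : ℂ)) ∧ W * V = V * Matrix.diagonal ν := by
  classical
  have hρW' : Commute ρ Wᴴ := by
    have h := congrArg Matrix.conjTranspose hρW.eq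
    rw [Matrix.conjTranspose_mul, Matrix.conjTranspose_mul, hρ.eq] at h
    exact h.symm
  -- The real and imaginary parts of `W` turn the problem into one about three Hermitian matrices.
  set A : Fin 3 → Matrix n n ℂ := ![ρ, W + Wᴴ, Complex.I • (W - Wᴴ)] with hA
  have hAh : ∀ i, (A i).IsHermitian := by
    intro i
    fin_cases i
    · exact hρ
    · change (W + Wᴴ)ᴴ = W + Wᴴ
      rw [Matrix.conjTranspose_add, Matrix.conjTranspose_conjTranspose, add_comm]
    · change (Complex.I • (W - Wᴴ))ᴴ = Complex.I • (W - Wᴴ)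
      rw [Matrix.conjTranspose_smul, Matrix.conjTranspose_sub, Matrix.conjTranspose_conjTranspose,
        Complex.star_def, Complex.conj_I, neg_smul, ← smul_neg, neg_sub]
  have h01 : Commute ρ (W + Wᴴ) := hρW.add_right hρW'
  have h02 : Commute ρ (Complex.I • (W - Wᴴ)) := (hρW.sub_right hρW').smul_right _
  have h12 : Commute (W + Wᴴ) (Complex.I • (W - Wᴴ)) :=
    (((Commute.refl W).sub_right hW).add_left (hW.symm.sub_right (Commute.refl _))).smul_right _
  have hAc : ∀ i j, Commute (A i) (A j) := by
    intro i j
    fin_cases i <;> fin_cases j <;>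
      first
      | exact Commute.refl _
      | exact h01 | exact h01.symm | exact h02 | exact h02.symm | exact h12 | exact h12.symm
  set T : Fin 3 → Module.End ℂ (EuclideanSpace ℂ n) := fun i => Matrix.toEuclideanLin (A i) with hT
  have hTs : ∀ i, (T i).IsSymmetric := fun i => Matrix.isSymmetric_toEuclideanLin_iff.2 (hAh i)
  have hTc : Pairwise (Function.onFun Commute T) := fun i j _ => by
    change T i * T j = T j * T i
    simp only [hT, Module.End.mul_eq_comp]
    rw [← Matrix.toLpLin_mul_same, ← Matrix.toLpLin_mul_same, (hAc i j).eq]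
  have hint := LinearMap.IsSymmetric.directSum_isInternal_of_pairwise_commute hTs hTc
  have hfin : Finite {α : Fin 3 → ℂ // (⨅ j, (T j).eigenspace (α j)) ≠ ⊥} :=
    (WellFoundedGT.finite_ne_bot_of_iSupIndep hint.submodule_iSupIndep).to_subtype
  have := Fintype.ofFinite {α : Fin 3 → ℂ // (⨅ j, (T j).eigenspace (α j)) ≠ ⊥}
  have hint' := DirectSum.isInternal_ne_bot_iff.2 hint
  have horth := (LinearMap.IsSymmetric.orthogonalFamily_iInf_eigenspaces hTs).comp
    (Subtype.val_injective (p := fun α : Fin 3 → ℂ => (⨅ j, (T j).eigenspace (α j)) ≠ ⊥))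
  have hcard : Module.finrank ℂ (EuclideanSpace ℂ n) = Fintype.card n := finrank_euclideanSpace
  set b0 := hint'.subordinateOrthonormalBasis hcard horth with hb0
  set b := b0.reindex (Fintype.equivFin n).symm with hb
  have hmem : ∀ l, ∃ α : Fin 3 → ℂ, ∀ j, A j *ᵥ (b l).ofLp = α j • (b l).ofLp := by
    intro l
    have h := hint'.subordinateOrthonormalBasis_subordinate hcard (Fintype.equivFin n l) horth
    refine ⟨(hint'.subordinateOrthonormalBasisIndex hcard (Fintype.equivFin n l) horth).val,
      fun j => ?_⟩
    have hj := Module.End.mem_eigenspace_iff.1 ((Submodule.mem_iInf _).1 h j)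
    have hbl : b l = b0 (Fintype.equivFin n l) := by simp [hb]
    rw [hbl]
    exact congrArg WithLp.ofLp hj
  choose α hα using hmem
  set V : Matrix n n ℂ := Matrix.of fun k l => b l k with hV
  have hVu : Vᴴ * V = 1 := by
    ext l m
    have h := (orthonormal_iff_ite.1 b.orthonormal) l m
    rw [Matrix.one_apply, ← h]
    simp [Matrix.mul_apply, hV, PiLp.inner_apply, mul_comm]
  have hcol : ∀ (B : Matrix n n ℂ) (ν : n → ℂ), (∀ l, B *ᵥ (b l).ofLp = ν l • (b l).ofLp) →
      B * V = V * Matrix.diagonal ν := by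
    intro B ν h
    ext k l
    have := congrFun (h l) k
    rw [Matrix.mul_diagonal]
    simpa [Matrix.mul_apply, Matrix.mulVec, dotProduct, hV, mul_comm] using this
  have hρV := hcol ρ (fun l => α l 0) fun l => hα l 0
  have hdiag : Matrix.diagonal (fun l => α l 0) = Vᴴ * ρ * V := by
    rw [Matrix.mul_assoc, hρV, ← Matrix.mul_assoc, hVu, Matrix.one_mul]
  have hreal : ∀ l, ((α l 0).re : ℂ) = α l 0 := by
    intro l
    have h : (Matrix.diagonal (fun l => α l 0)).IsHermitian := by
      rw [hdiag]
      exact Matrix.isHermitian_conjTranspose_mul_mul V hρ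
    have h2 := congrFun (congrFun h.eq l) l
    simp only [Matrix.conjTranspose_apply, Matrix.diagonal_apply_eq] at h2
    exact Complex.conj_eq_iff_re.1 h2
  refine ⟨V, fun l => (α l 0).re, fun l => (α l 1 - Complex.I * α l 2) / 2, hVu, ?_, ?_⟩
  · simp only [hreal]
    exact hρV
  · refine hcol W _ fun l => ?_
    have h1 : (W + Wᴴ) *ᵥ (b l).ofLp = α l 1 • (b l).ofLp := hα l 1
    have h2 : (Complex.I • (W - Wᴴ)) *ᵥ (b l).ofLp = α l 2 • (b l).ofLp := hα l 2
    have hWeq : W = (2⁻¹ : ℂ) • ((W + Wᴴ) - Complex.I • Complex.I • (W - Wᴴ)) := by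
      rw [smul_smul, Complex.I_mul_I]
      module
    conv_lhs => rw [hWeq]
    rw [Matrix.smul_mulVec, Matrix.sub_mulVec, Matrix.smul_mulVec, h1, h2]
    module

lemma aeval_mul_of_diagonalizing {ρ V : Matrix n n ℂ} {lam : n → ℝ}
    (h : ρ * V = V * Matrix.diagonal (fun l => (lam l : ℂ))) (P : Polynomial ℝ) :
    Polynomial.aeval ρ P * V = V * Matrix.diagonal (fun l => ((P.eval (lam l) : ℝ) : ℂ)) := by
  induction P using Polynomial.induction_on' with
  | add P Q hP hQ =>
    simp only [map_add, add_mul, hP, hQ, Polynomial.eval_add, Complex.ofReal_add]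
    rw [← Matrix.diagonal_add, mul_add]
  | monomial m c =>
    have hs : SemiconjBy V (Matrix.diagonal (fun l => (lam l : ℂ))) ρ := h.symm
    have hpow := (hs.pow_right m).eq
    rw [Matrix.diagonal_pow] at hpow
    rw [Polynomial.aeval_monomial, mul_assoc, ← hpow, ← Algebra.smul_def, ← Matrix.mul_smul]
    congr 1
    ext i j
    by_cases hij : i = j
    · subst hij
      simp
    · simp [hij]

lemma isHermitian_of_diagonalizing {ρ V : Matrix n n ℂ} {lam : n → ℝ} (hV : Vᴴ * V = 1)
    (h : ρ * V = V * Matrix.diagonal (fun l => (lam l : ℂ))) : ρ.IsHermitian := by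
  have hV' : V * Vᴴ = 1 := mul_eq_one_comm.1 hV
  have hρ : ρ = V * Matrix.diagonal (fun l => (lam l : ℂ)) * Vᴴ := by
    rw [← h, Matrix.mul_assoc, hV', Matrix.mul_one]
  rw [hρ]
  refine Matrix.isHermitian_mul_mul_conjTranspose V ?_
  rw [Matrix.IsHermitian, Matrix.diagonal_conjTranspose]
  congr 1
  ext l
  simp

/-- On finite spectra the functional calculus is polynomial, so it can be evaluated in any
orthonormal eigenbasis. -/
lemma cfc_mul_of_diagonalizing {ρ V : Matrix n n ℂ} {lam : n → ℝ} (hV : Vᴴ * V = 1)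
    (h : ρ * V = V * Matrix.diagonal (fun l => (lam l : ℂ))) (f : ℝ → ℝ) :
    cfc f ρ * V = V * Matrix.diagonal (fun l => ((f (lam l) : ℝ) : ℂ)) := by
  have hρ : IsSelfAdjoint ρ := isHermitian_of_diagonalizing hV h
  set s : Finset ℝ := ρ.finite_real_spectrum.toFinset ∪ Finset.univ.image lam with hs
  set P := Lagrange.interpolate s id f with hP
  have hPs : ∀ x ∈ s, P.eval x = f x := fun x hx =>
    Lagrange.eval_interpolate_at_node (v := id) f Function.injective_id.injOn hx
  have hcfc : cfc f ρ = Polynomial.aeval ρ P := by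
    rw [← cfc_polynomial P ρ hρ]
    exact cfc_congr fun x hx => (hPs x (Finset.mem_union_left _ (by simpa using hx))).symm
  rw [hcfc, aeval_mul_of_diagonalizing h]
  congr 2
  funext l
  rw [hPs _ (Finset.mem_union_right _ (Finset.mem_image_of_mem _ (Finset.mem_univ l)))]

lemma trace_of_diagonalizing {M V : Matrix n n ℂ} {x : n → ℂ} (hV : Vᴴ * V = 1)
    (h : M * V = V * Matrix.diagonal x) : M.trace = ∑ l, x l := by
  have hV' : V * Vᴴ = 1 := mul_eq_one_comm.1 hV
  have hM : M = V * Matrix.diagonal x * Vᴴ := by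
    rw [← h, Matrix.mul_assoc, hV', Matrix.mul_one]
  rw [hM, Matrix.mul_assoc, Matrix.trace_mul_comm, Matrix.mul_assoc, hV, Matrix.mul_one,
    Matrix.trace_diagonal]

end Diagonalization

lemma vonNeumann_eq_shannon {ρ V : Matrix (ZMod d) (ZMod d) ℂ} {lam : ZMod d → ℝ} (hV : Vᴴ * V = 1)
    (h : ρ * V = V * Matrix.diagonal (fun l => (lam l : ℂ))) : vonNeumann ρ = shannon lam := by
  have h2 : ρ * cfc (Real.logb 2) ρ * V =
      V * Matrix.diagonal (fun l => ((lam l * Real.logb 2 (lam l) : ℝ) : ℂ)) := by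
    rw [Matrix.mul_assoc, cfc_mul_of_diagonalizing hV h, ← Matrix.mul_assoc, h, Matrix.mul_assoc,
      Matrix.diagonal_mul_diagonal]
    simp
  rw [vonNeumann, trace_of_diagonalizing hV h2, shannon, ← Complex.ofReal_sum, Complex.ofReal_re]

/-! ### Weyl operators -/

lemma omega_pow (m : ℕ) : omega d ^ m = ZMod.stdAddChar (m : ZMod d) := by
  have h := ZMod.stdAddChar_coe (N := d) m
  rw [Int.cast_natCast] at h
  rw [h, omega, ← Complex.exp_nat_mul]
  congr 1
  push_cast
  ring

lemma weyl_apply (a : Idx d) (k j : ZMod d) :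
    weyl a k j = if j = k + a.2 then ZMod.stdAddChar (k * a.1) else 0 := by
  rw [weyl, Matrix.sum_apply, Finset.sum_eq_single k]
  · rw [Matrix.smul_apply, Matrix.single_apply, omega_pow]
    simp [eq_comm]
  · intro i _ hi
    simp [hi]
  · simp

lemma weyl_mulVec (a : Idx d) (ψ : ZMod d → ℂ) (k : ZMod d) :
    (weyl a *ᵥ ψ) k = ZMod.stdAddChar (k * a.1) * ψ (k + a.2) := by
  simp [Matrix.mulVec, dotProduct, weyl_apply]

lemma stdAddChar_mul_conj (x : ZMod d) :
    ZMod.stdAddChar x * (starRingEnd ℂ) (ZMod.stdAddChar x) = 1 := by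
  rw [← AddChar.map_neg_eq_conj, ← AddChar.map_add_eq_mul, add_neg_cancel, AddChar.map_zero_eq_one]

lemma weyl_mul_conjTranspose (a : Idx d) : weyl a * (weyl a)ᴴ = 1 := by
  ext k k'
  rw [Matrix.mul_apply, Finset.sum_eq_single (k + a.2)]
  · by_cases h : k = k'
    · subst h
      simp [weyl_apply, stdAddChar_mul_conj]
    · simp [weyl_apply, h]
  · intro j _ hj
    simp [weyl_apply, hj]
  · simp

lemma conjTranspose_mul_weyl (a : Idx d) : (weyl a)ᴴ * weyl a = 1 :=
  mul_eq_one_comm.1 (weyl_mul_conjTranspose a)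

/-- The commutation relation `W_a W_b = ω ^ symp(a, b) W_b W_a`. -/
lemma weyl_mulVec_weyl_mulVec (a b : Idx d) (ψ : ZMod d → ℂ) :
    weyl a *ᵥ (weyl b *ᵥ ψ) =
      (ZMod.stdAddChar (symp a b) : ℂ) • (weyl b *ᵥ (weyl a *ᵥ ψ)) := by
  funext k
  simp only [weyl_mulVec, Pi.smul_apply, smul_eq_mul]
  have h : (ZMod.stdAddChar (k * a.1) : ℂ) * ZMod.stdAddChar ((k + a.2) * b.1) =
      ZMod.stdAddChar (symp a b) * ZMod.stdAddChar (k * b.1) *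
        ZMod.stdAddChar ((k + b.2) * a.1) := by
    simp only [← AddChar.map_add_eq_mul]
    congr 1
    rw [symp]
    ring
  rw [← mul_assoc, h, add_right_comm]
  ring

lemma star_dotProduct_self (x : ZMod d → ℂ) : star x ⬝ᵥ x = ((∑ k, ‖x k‖ ^ 2 : ℝ) : ℂ) := by
  simp only [dotProduct, Pi.star_apply, Complex.star_def, Complex.ofReal_sum, Complex.ofReal_pow]
  exact Finset.sum_congr rfl fun k _ => Complex.conj_mul' _

lemma star_mulVec_dotProduct_mulVec {U : Matrix (ZMod d) (ZMod d) ℂ} (hU : Uᴴ * U = 1)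
    (x y : ZMod d → ℂ) : star (U *ᵥ x) ⬝ᵥ (U *ᵥ y) = star x ⬝ᵥ y := by
  rw [Matrix.star_mulVec, ← Matrix.dotProduct_mulVec, Matrix.mulVec_mulVec, hU, Matrix.one_mulVec]

lemma sum_norm_sq_mulVec {U : Matrix (ZMod d) (ZMod d) ℂ} (hU : Uᴴ * U = 1) (x : ZMod d → ℂ) :
    ∑ k, ‖(U *ᵥ x) k‖ ^ 2 = ∑ k, ‖x k‖ ^ 2 := by
  have h := star_mulVec_dotProduct_mulVec hU x x
  rw [star_dotProduct_self, star_dotProduct_self] at h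
  exact_mod_cast h

/-- Parseval's identity on `ZMod d`. -/
lemma sum_norm_sq_sum_stdAddChar (f : ZMod d → ℂ) :
    ∑ n : ZMod d, ‖∑ k, f k * ZMod.stdAddChar (k * n)‖ ^ 2 = d * ∑ k, ‖f k‖ ^ 2 := by
  have key : ∑ n : ZMod d, (∑ k, f k * ZMod.stdAddChar (k * n)) *
      (starRingEnd ℂ) (∑ k, f k * ZMod.stdAddChar (k * n)) =
      d * ∑ k, f k * (starRingEnd ℂ) (f k) := by
    simp only [map_sum, map_mul, ← AddChar.map_neg_eq_conj, Finset.sum_mul_sum]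
    rw [Finset.sum_comm, Finset.mul_sum]
    refine Finset.sum_congr rfl fun k _ => ?_
    rw [Finset.sum_comm, Finset.sum_eq_single k]
    · simp only [mul_mul_mul_comm, ← AddChar.map_add_eq_mul, add_neg_cancel,
        AddChar.map_zero_eq_one, mul_one, Finset.sum_const, Finset.card_univ, ZMod.card,
        nsmul_eq_mul]
    · intro j _ hj
      have h := AddChar.sum_mulShift (k - j) (ZMod.isPrimitive_stdAddChar d)
      rw [if_neg (sub_ne_zero.2 (Ne.symm hj)), Nat.cast_zero] at h
      simp only [mul_mul_mul_comm, ← AddChar.map_add_eq_mul, ← Finset.mul_sum]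
      rw [← mul_zero (f k * (starRingEnd ℂ) (f j)), ← h]
      congr 1
      refine Finset.sum_congr rfl fun n _ => ?_
      congr 1
      ring
    · simp
  simp only [Complex.mul_conj'] at key
  exact_mod_cast key

/-- The twirling identity `∑_b |⟨φ, W_b ψ⟩|² = d ‖φ‖² ‖ψ‖²`, which expresses that the uniform
mixture of all Weyl operators is completely depolarizing. -/
lemma sum_norm_sq_dotProduct_weyl (φ ψ : ZMod d → ℂ) :
    ∑ b : Idx d, ‖φ ⬝ᵥ (weyl b *ᵥ ψ)‖ ^ 2 = d * (∑ k, ‖φ k‖ ^ 2) * ∑ k, ‖ψ k‖ ^ 2 := by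
  rw [Fintype.sum_prod_type, Finset.sum_comm]
  have h : ∀ m : ZMod d, ∑ n : ZMod d, ‖φ ⬝ᵥ (weyl (n, m) *ᵥ ψ)‖ ^ 2 =
      d * ∑ k, ‖φ k‖ ^ 2 * ‖ψ (k + m)‖ ^ 2 := by
    intro m
    have := sum_norm_sq_sum_stdAddChar fun k => φ k * ψ (k + m)
    simp only [norm_mul, mul_pow] at this
    rw [← this]
    refine Finset.sum_congr rfl fun n _ => ?_
    simp only [dotProduct, weyl_mulVec]
    congr 2
    exact Finset.sum_congr rfl fun k _ => by ring
  simp only [h]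
  rw [← Finset.mul_sum, Finset.sum_comm, mul_assoc, Finset.sum_mul]
  congr 1
  refine Finset.sum_congr rfl fun k _ => ?_
  rw [← Finset.mul_sum]
  congr 1
  exact Fintype.sum_equiv (Equiv.addLeft k) _ _ fun j => rfl

/-! ### Weyl channels on eigenstates of a Weyl operator -/

lemma channel_pureState (p : Idx d → ℝ) (ψ : ZMod d → ℂ) :
    channel p (pureState ψ) = ∑ b, (p b : ℂ) • pureState (weyl b *ᵥ ψ) := by
  refine Finset.sum_congr rfl fun b _ => ?_
  rw [pureState, pureState, Matrix.mul_vecMulVec, Matrix.vecMulVec_mul, Matrix.star_mulVec]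

lemma isHermitian_pureState (ψ : ZMod d → ℂ) : (pureState ψ).IsHermitian := by
  ext i j
  simp [pureState, Matrix.vecMulVec_apply, mul_comm]

lemma isHermitian_channel_pureState (p : Idx d → ℝ) (ψ : ZMod d → ℂ) :
    (channel p (pureState ψ)).IsHermitian := by
  rw [channel_pureState, Matrix.IsHermitian, Matrix.conjTranspose_sum]
  refine Finset.sum_congr rfl fun b _ => ?_
  rw [Matrix.conjTranspose_smul, (isHermitian_pureState _).eq, Complex.star_def,
    Complex.conj_ofReal]

lemma commute_pureState {U : Matrix (ZMod d) (ZMod d) ℂ} (hU : Uᴴ * U = 1) {x : ZMod d → ℂ} {ν : ℂ}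
    (hν : ν * (starRingEnd ℂ) ν = 1) (hx : U *ᵥ x = ν • x) : Commute (pureState x) U := by
  have hx' : Uᴴ *ᵥ x = (starRingEnd ℂ) ν • x := by
    have h := congrArg (fun y => (starRingEnd ℂ) ν • (Uᴴ *ᵥ y)) hx
    simp only [Matrix.mulVec_mulVec, hU, Matrix.one_mulVec, Matrix.mulVec_smul, smul_smul] at h
    rw [mul_comm, hν, one_smul] at h
    exact h.symm
  have hx'' : star x ᵥ* U = ν • star x := by
    have h := congrArg star hx'
    rw [Matrix.star_mulVec, Matrix.conjTranspose_conjTranspose] at h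
    rw [h]
    funext k
    simp
  change pureState x * U = U * pureState x
  rw [pureState, Matrix.mul_vecMulVec, Matrix.vecMulVec_mul, hx, hx'', Matrix.vecMulVec_smul,
    Matrix.smul_vecMulVec]

lemma sum_norm_sq_of_isEigenstate {a : Idx d} {ψ : ZMod d → ℂ} (h : IsEigenstate a ψ) :
    ∑ k, ‖ψ k‖ ^ 2 = 1 := by
  have := h.1
  rw [star_dotProduct_self] at this
  exact_mod_cast this

lemma eigenvalue_mul_conj {a : Idx d} {ψ : ZMod d → ℂ} (hψ : star ψ ⬝ᵥ ψ = 1) {μ : ℂ}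
    (h : weyl a *ᵥ ψ = μ • ψ) : μ * (starRingEnd ℂ) μ = 1 := by
  have h1 := star_mulVec_dotProduct_mulVec (conjTranspose_mul_weyl a) ψ ψ
  rw [h, star_smul, smul_dotProduct, dotProduct_smul, hψ] at h1
  simpa [mul_comm] using h1

/-- The output of the channel on an eigenstate of `W_a` has an orthonormal eigenbasis `φ_l` that
also consists of eigenvectors of `W_a`. The overlaps `q b l = |⟨φ_l, W_b ψ⟩|²` are a doubly stochastic
array, up to the factor `d`, and vanish unless `symp a b` is the value `k l` belonging to `φ_l`; the
eigenvalues of the output are `∑_b p_b q b l`. -/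
lemma exists_overlaps (p : Idx d → ℝ) {a : Idx d} {ψ : ZMod d → ℂ} (hψ : IsEigenstate a ψ) :
    ∃ (q : Idx d → ZMod d → ℝ) (k : ZMod d → ZMod d), (∀ b l, 0 ≤ q b l) ∧
      (∀ b, ∑ l, q b l = 1) ∧ (∀ l, ∑ b, q b l = d) ∧ (∀ b l, q b l ≠ 0 → symp a b = k l) ∧
      vonNeumann (channel p (pureState ψ)) = shannon (fun l => ∑ b, p b * q b l) ∧
      (channel p (pureState ψ) * channel p (pureState ψ)).trace.re =
        ∑ l, (∑ b, p b * q b l) ^ 2 := by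
  have hψn := sum_norm_sq_of_isEigenstate hψ
  obtain ⟨hψ1, μ, hμ⟩ := hψ
  have hμ1 := eigenvalue_mul_conj hψ1 hμ
  have hμ0 : μ ≠ 0 := fun h => by simp [h] at hμ1
  have heig : ∀ b, weyl a *ᵥ (weyl b *ᵥ ψ) = (ZMod.stdAddChar (symp a b) * μ) • (weyl b *ᵥ ψ) := by
    intro b
    rw [weyl_mulVec_weyl_mulVec, hμ, Matrix.mulVec_smul, smul_smul]
  set ρ := channel p (pureState ψ) with hρdef
  have hcomm : Commute ρ (weyl a) := by
    rw [hρdef, channel_pureState]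
    refine Commute.sum_left _ _ _ fun b _ => Commute.smul_left ?_ _
    refine commute_pureState (conjTranspose_mul_weyl a) ?_ (heig b)
    rw [map_mul, mul_mul_mul_comm, hμ1, stdAddChar_mul_conj, one_mul]
  obtain ⟨V, lam, ν, hV, hρV, hWV⟩ := exists_unitary_diagonalizing
    (isHermitian_channel_pureState p ψ)
    (show weyl a * (weyl a)ᴴ = (weyl a)ᴴ * weyl a by
      rw [weyl_mul_conjTranspose, conjTranspose_mul_weyl]) hcomm
  have hV' : V * Vᴴ = 1 := mul_eq_one_comm.1 hV
  set q : Idx d → ZMod d → ℝ := fun b l => ‖(Vᴴ *ᵥ (weyl b *ᵥ ψ)) l‖ ^ 2 with hq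
  have hrow : ∀ b, ∑ l, q b l = 1 := fun b => by
    simp only [hq]
    rw [sum_norm_sq_mulVec (by rwa [Matrix.conjTranspose_conjTranspose]),
      sum_norm_sq_mulVec (conjTranspose_mul_weyl b), hψn]
  have hcol : ∀ l, ∑ b, q b l = d := fun l => by
    have h := sum_norm_sq_dotProduct_weyl (fun k => Vᴴ l k) ψ
    have hl : ∑ k, ‖Vᴴ l k‖ ^ 2 = 1 := by
      have h1 := congrFun (congrFun hV l) l
      rw [Matrix.mul_apply, Matrix.one_apply_eq] at h1
      have h2 : ∀ k, Vᴴ l k * V k l = ((‖Vᴴ l k‖ ^ 2 : ℝ) : ℂ) := fun k => by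
        rw [Matrix.conjTranspose_apply, Complex.star_def, Complex.conj_mul', Complex.norm_conj]
        push_cast
        rfl
      simp only [h2] at h1
      exact_mod_cast h1
    rw [hl, hψn, mul_one, mul_one] at h
    exact h
  have hWV' : Vᴴ * weyl a = Matrix.diagonal ν * Vᴴ := by
    calc Vᴴ * weyl a = Vᴴ * (weyl a * V) * Vᴴ := by
          rw [Matrix.mul_assoc, Matrix.mul_assoc (weyl a), hV', Matrix.mul_one]
      _ = Matrix.diagonal ν * Vᴴ := by
          rw [hWV, ← Matrix.mul_assoc, hV, Matrix.one_mul]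
  have hsupp : ∀ b l, q b l ≠ 0 → ν l = ZMod.stdAddChar (symp a b) * μ := by
    intro b l hbl
    have hne : (Vᴴ *ᵥ (weyl b *ᵥ ψ)) l ≠ 0 := fun h => hbl (by simp only [hq, h]; simp)
    have h := congrArg (fun x => (Vᴴ *ᵥ x) l) (heig b)
    simp only [Matrix.mulVec_smul, Pi.smul_apply, smul_eq_mul] at h
    rw [Matrix.mulVec_mulVec, hWV', ← Matrix.mulVec_mulVec, Matrix.mulVec_diagonal] at h
    exact mul_right_cancel₀ hne h
  have hex : ∀ l, ∃ b, q b l ≠ 0 := by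
    intro l
    by_contra! h
    have := hcol l
    simp only [h, Finset.sum_const_zero] at this
    exact NeZero.ne d (by exact_mod_cast this.symm)
  choose β hβ using hex
  have hlam : lam = fun l => ∑ b, p b * q b l := by
    funext l
    have hdiag : Vᴴ * ρ * V = Matrix.diagonal (fun l => (lam l : ℂ)) := by
      rw [Matrix.mul_assoc, hρV, ← Matrix.mul_assoc, hV, Matrix.one_mul]
    have hl := congrFun (congrFun hdiag l) l
    rw [Matrix.diagonal_apply_eq, hρdef, channel_pureState, Finset.mul_sum, Finset.sum_mul,
      Matrix.sum_apply] at hl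
    have hterm : ∀ b, (Vᴴ * ((p b : ℂ) • pureState (weyl b *ᵥ ψ)) * V) l l =
        ((p b * q b l : ℝ) : ℂ) := by
      intro b
      rw [Matrix.mul_smul, Matrix.smul_mul, pureState, Matrix.mul_vecMulVec, Matrix.vecMulVec_mul,
        Matrix.smul_apply, Matrix.vecMulVec_apply, ← Matrix.conjTranspose_conjTranspose V,
        ← Matrix.star_mulVec, Matrix.conjTranspose_conjTranspose, Pi.star_apply, Complex.star_def,
        Complex.mul_conj']
      simp [hq]
    simp only [hterm] at hl
    rw [← Complex.ofReal_sum] at hl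
    exact_mod_cast hl.symm
  refine ⟨q, fun l => symp a (β l), fun b l => by positivity, hrow, hcol, fun b l hbl => ?_, ?_, ?_⟩
  · have h := (hsupp b l hbl).symm.trans (hsupp _ l (hβ l))
    exact ZMod.injective_stdAddChar (mul_right_cancel₀ hμ0 h)
  · rw [← hlam, vonNeumann_eq_shannon hV hρV]
  · have h2 : ρ * ρ * V = V * Matrix.diagonal (fun l => ((lam l ^ 2 : ℝ) : ℂ)) := by
      rw [Matrix.mul_assoc, hρV, ← Matrix.mul_assoc, hρV, Matrix.mul_assoc,
        Matrix.diagonal_mul_diagonal]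
      simp [sq]
    rw [trace_of_diagonalizing hV h2, ← Complex.ofReal_sum, Complex.ofReal_re, hlam]

/-! ### From eigenstates to arrangements -/

lemma shannon_eq_negMulLog {ι : Type} [Fintype ι] (v : ι → ℝ) :
    shannon v = (Real.log 2)⁻¹ * ∑ i, Real.negMulLog (v i) := by
  simp only [shannon_eq_log, Real.negMulLog, neg_mul, Finset.sum_neg_distrib]
  ring

lemma concaveOn_shannon (ι : Type) [Fintype ι] :
    ConcaveOn ℝ {v : ι → ℝ | ∀ i, 0 ≤ v i} shannon := by
  have hlog : 0 ≤ (Real.log 2)⁻¹ := inv_nonneg.2 (Real.log_nonneg (by norm_num))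
  refine ⟨fun x hx y hy a b ha hb _ i => ?_, fun x hx y hy a b ha hb hab => ?_⟩
  · have := mul_nonneg ha (hx i)
    have := mul_nonneg hb (hy i)
    simp only [Pi.add_apply, Pi.smul_apply, smul_eq_mul]
    linarith
  · simp only [shannon_eq_negMulLog, smul_eq_mul]
    rw [mul_left_comm, mul_left_comm b, ← mul_add]
    refine mul_le_mul_of_nonneg_left ?_ hlog
    rw [Finset.mul_sum, Finset.mul_sum, ← Finset.sum_add_distrib]
    exact Finset.sum_le_sum fun i _ => Real.concaveOn_negMulLog.2 (hx i) (hy i) ha hb hab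

/-- By Birkhoff's theorem an array of overlaps is a mixture of assignments of the index pairs to
blocks of size `d`; by concavity one of these assignments has no larger entropy. -/
lemma exists_arrangement_of_overlaps {p : Idx d → ℝ} (hp : ∀ b, 0 ≤ p b) {a : Idx d}
    {q : Idx d → ZMod d → ℝ} {k : ZMod d → ZMod d} (hq : ∀ b l, 0 ≤ q b l)
    (hrow : ∀ b, ∑ l, q b l = 1) (hcol : ∀ l, ∑ b, q b l = d)
    (hsupp : ∀ b l, q b l ≠ 0 → symp a b = k l) :
    ∃ (σ : Fin (d * d) ≃ Idx d) (k' : Fin d → ZMod d),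
      (∀ i r, symp a (σ (finProdFinEquiv (i, r))) = k' i) ∧
      shannon (blockSum p σ) ≤ shannon fun l => ∑ b, p b * q b l := by
  have hd : (d : ℝ) ≠ 0 := Nat.cast_ne_zero.2 (NeZero.ne d)
  obtain ⟨f, -⟩ := exists_vec_equiv d
  have e : Fin d ≃ ZMod d := Fintype.equivOfCardEq (by simp [ZMod.card])
  set M : Matrix (Fin (d * d)) (Fin (d * d)) ℝ :=
    Matrix.of fun s t => q (f s) (e (finProdFinEquiv.symm t).1) / d with hM
  have hMs : M ∈ doublyStochastic ℝ (Fin (d * d)) := by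
    refine mem_doublyStochastic_iff_sum.2 ⟨fun s t => ?_, fun s => ?_, fun t => ?_⟩
    · exact div_nonneg (hq _ _) (Nat.cast_nonneg d)
    · rw [sum_finProdFinEquiv]
      simp only [hM, Matrix.of_apply, Equiv.symm_apply_apply, Finset.sum_const, Finset.card_univ,
        Fintype.card_fin, nsmul_eq_mul, mul_div_cancel₀ _ hd]
      rw [e.sum_comp fun l => q (f s) l, hrow]
    · simp only [hM, Matrix.of_apply]
      rw [← Finset.sum_div, f.sum_comp fun b => q b (e (finProdFinEquiv.symm t).1), hcol,
        div_self hd]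
  obtain ⟨w, hw0, hw1, hwM⟩ := exists_eq_sum_perm_of_mem_doublyStochastic hMs
  have hMapply : ∀ s t, M s t = ∑ π : Equiv.Perm (Fin (d * d)), if π s = t then w π else 0 := by
    intro s t
    rw [← hwM, Matrix.sum_apply]
    refine Finset.sum_congr rfl fun π _ => ?_
    simp [Equiv.Perm.permMatrix, PEquiv.toMatrix_apply, Equiv.toPEquiv_apply, eq_comm]
  have hlam : ∀ i, ∑ b, p b * q b (e i) =
      ∑ π : Equiv.Perm (Fin (d * d)), w π * blockSum p (π.symm.trans f) i := by
    intro i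
    calc ∑ b, p b * q b (e i) = ∑ s, p (f s) * q (f s) (e i) :=
          (f.sum_comp fun b => p b * q b (e i)).symm
      _ = ∑ s, ∑ r : Fin d, p (f s) * M s (finProdFinEquiv (i, r)) := by
          refine Finset.sum_congr rfl fun s _ => ?_
          simp only [hM, Matrix.of_apply, Equiv.symm_apply_apply, Finset.sum_const,
            Finset.card_univ, Fintype.card_fin, nsmul_eq_mul]
          field_simp
      _ = ∑ π : Equiv.Perm (Fin (d * d)), ∑ r : Fin d, ∑ s,
            if π s = finProdFinEquiv (i, r) then w π * p (f s) else 0 := by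
          simp only [hMapply, Finset.mul_sum]
          rw [Finset.sum_comm]
          simp only [fun r : Fin d => Finset.sum_comm (s := (Finset.univ : Finset (Fin (d * d))))
            (t := (Finset.univ : Finset (Equiv.Perm (Fin (d * d)))))
            (f := fun s π => p (f s) * if π s = finProdFinEquiv (i, r) then w π else 0)]
          rw [Finset.sum_comm]
          refine Finset.sum_congr rfl fun π _ => Finset.sum_congr rfl fun r _ =>
            Finset.sum_congr rfl fun s _ => ?_
          split_ifs <;> ring
      _ = _ := by
          refine Finset.sum_congr rfl fun π _ => ?_
          rw [blockSum, Finset.mul_sum]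
          refine Finset.sum_congr rfl fun r _ => ?_
          simp [← Equiv.eq_symm_apply]
  set t : Finset (Equiv.Perm (Fin (d * d))) := Finset.univ.filter fun π => w π ≠ 0 with ht
  have htw : ∑ π ∈ t, w π = 1 := by rw [ht, Finset.sum_filter_ne_zero, hw1]
  obtain ⟨π, hπ, hle⟩ := (concaveOn_shannon (Fin d)).exists_le_of_centerMass (t := t) (w := w)
    (p := fun π => blockSum p (π.symm.trans f)) (fun π _ => hw0 π) (by rw [htw]; norm_num)
    (fun π _ => blockSum_nonneg hp _)
  refine ⟨π.symm.trans f, fun i => k (e i), fun i r => ?_, hle.trans_eq ?_⟩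
  · refine hsupp _ _ fun h0 => (Finset.mem_filter.1 hπ).2 ?_
    have h := hMapply (π.symm (finProdFinEquiv (i, r))) (finProdFinEquiv (i, r))
    simp only [hM, Matrix.of_apply, Equiv.symm_apply_apply] at h
    rw [Equiv.trans_apply] at h0
    rw [h0, zero_div, eq_comm, Finset.sum_eq_zero_iff_of_nonneg
      (fun π _ => by split_ifs <;> simp [hw0])] at h
    simpa using h π (Finset.mem_univ _)
  · rw [ht, Finset.centerMass_filter_ne_zero, Finset.centerMass_eq_of_sum_1 _ _ hw1,
      ← shannon_comp_equiv e]
    congr 1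
    funext i
    rw [hlam]
    simp

lemma exists_arrangement_of_isEigenstate {p : Idx d → ℝ} (hp : ∀ b, 0 ≤ p b) {a : Idx d}
    {ψ : ZMod d → ℂ} (hψ : IsEigenstate a ψ) :
    ∃ (σ : Fin (d * d) ≃ Idx d) (k : Fin d → ZMod d),
      (∀ i r, symp a (σ (finProdFinEquiv (i, r))) = k i) ∧
      shannon (blockSum p σ) ≤ vonNeumann (channel p (pureState ψ)) := by
  obtain ⟨q, k, hq, hrow, hcol, hsupp, hS, -⟩ := exists_overlaps p hψ
  rw [hS]
  exact exists_arrangement_of_overlaps hp hq hrow hcol hsupp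

lemma shannon_zeta_le_vonNeumann {p : Idx d → ℝ} (hp : ∀ b, 0 ≤ p b) {a : Idx d}
    {ψ : ZMod d → ℂ} (hψ : IsEigenstate a ψ) :
    shannon (zeta p) ≤ vonNeumann (channel p (pureState ψ)) := by
  obtain ⟨σ, -, -, hσ⟩ := exists_arrangement_of_isEigenstate hp hψ
  exact (shannon_zeta_le hp σ).trans hσ

lemma exists_isEigenstate (a : Idx d) : ∃ ψ, IsEigenstate a ψ := by
  obtain ⟨μ, hμ⟩ := Module.End.exists_eigenvalue (Matrix.toLin' (weyl a))
  obtain ⟨v, hv⟩ := hμ.exists_hasEigenvector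
  have hv1 : weyl a *ᵥ v = μ • v := by simpa using hv.apply_eq_smul
  have hpos : 0 < ∑ k, ‖v k‖ ^ 2 := by
    obtain ⟨k, hk⟩ := Function.ne_iff.1 hv.2
    exact Finset.sum_pos' (fun _ _ => by positivity)
      ⟨k, Finset.mem_univ k, by have := norm_pos_iff.2 hk; positivity⟩
  set c : ℝ := (√(∑ k, ‖v k‖ ^ 2))⁻¹ with hc
  refine ⟨(c : ℂ) • v, ?_, μ, ?_⟩
  · rw [star_smul, smul_dotProduct, dotProduct_smul, star_dotProduct_self, smul_smul, smul_eq_mul,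
      Complex.star_def, Complex.conj_ofReal, ← Complex.ofReal_mul, ← Complex.ofReal_mul, hc,
      ← mul_inv, Real.mul_self_sqrt hpos.le, inv_mul_cancel₀ hpos.ne', Complex.ofReal_one]
  · rw [Matrix.mulVec_smul, hv1, smul_comm]

lemma exists_ne_zero (hd : 1 < d) : ∃ a : Idx d, a ≠ 0 := by
  have := Fact.mk hd
  exact exists_ne 0

/-- The set of output entropies over which `eigenLowerBound` minimizes. -/
def eigenEntropies (p : Idx d → ℝ) : Set ℝ :=
  {s : ℝ | ∃ a : Idx d, a ≠ 0 ∧ ∃ ψ : ZMod d → ℂ,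
    IsEigenstate a ψ ∧ s = vonNeumann (channel p (pureState ψ))}

lemma eigenLowerBound_eq_upperBound_iff (p : Idx d → ℝ) :
    eigenLowerBound p = upperBound p ↔ sInf (eigenEntropies p) = shannon (zeta p) := by
  rw [eigenLowerBound, upperBound, eigenEntropies, sub_right_inj]

lemma eigenEntropies_nonempty (hd : 1 < d) (p : Idx d → ℝ) : (eigenEntropies p).Nonempty := by
  obtain ⟨a, ha⟩ := exists_ne_zero hd
  obtain ⟨ψ, hψ⟩ := exists_isEigenstate a
  exact ⟨_, a, ha, ψ, hψ, rfl⟩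

/-- The infimum over eigenstates is bounded below by the minimum over the finitely many arrangements
with achievable blocks, so no compactness argument is needed. -/
lemma sortedAchievable_of_eigenLowerBound_eq (hd : 1 < d) {p : Idx d → ℝ} (hp : ∀ b, 0 ≤ p b)
    (h : eigenLowerBound p = upperBound p) : SortedAchievable p := by
  classical
  rw [eigenLowerBound_eq_upperBound_iff] at h
  set F : Finset (Fin (d * d) ≃ Idx d) := Finset.univ.filter fun σ => ∃ a : Idx d, a ≠ 0 ∧
    ∃ k : Fin d → ZMod d, ∀ i r, symp a (σ (finProdFinEquiv (i, r))) = k i with hF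
  have hFS : ∀ s ∈ eigenEntropies p, ∃ σ ∈ F, shannon (blockSum p σ) ≤ s := by
    rintro s ⟨a, ha, ψ, hψ, rfl⟩
    obtain ⟨σ, k, hk, hσ⟩ := exists_arrangement_of_isEigenstate hp hψ
    exact ⟨σ, Finset.mem_filter.2 ⟨Finset.mem_univ _, a, ha, k, hk⟩, hσ⟩
  have hne := eigenEntropies_nonempty hd p
  have hFne : F.Nonempty := by
    obtain ⟨s, hs⟩ := hne
    obtain ⟨σ, hσ, -⟩ := hFS s hs
    exact ⟨σ, hσ⟩
  obtain ⟨σ, hσ, hmin⟩ := F.exists_min_image (fun σ => shannon (blockSum p σ)) hFne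
  obtain ⟨a, ha, k, hk⟩ := (Finset.mem_filter.1 hσ).2
  refine sortedAchievable_of_shannon_le hp ha σ k hk ?_
  rw [← h]
  refine le_csInf hne fun s hs => ?_
  obtain ⟨σ', hσ', hle⟩ := hFS s hs
  exact (hmin σ' hσ').trans hle

/-! ### Prime dimension -/

/-- For prime `d` the value `k l` determines the eigenvector `φ_l`, so the overlaps are indicators
of the fibres of the symplectic form. -/
lemma vonNeumann_eq_shannon_transProb (hd : d.Prime) (p : Idx d → ℝ) {a : Idx d} (ha : a ≠ 0)
    {ψ : ZMod d → ℂ} (hψ : IsEigenstate a ψ) :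
    vonNeumann (channel p (pureState ψ)) = shannon (transProb p a) := by
  obtain ⟨q, k, -, hrow, -, hsupp, hS, -⟩ := exists_overlaps p hψ
  have hsurj : Function.Surjective k := fun c => by
    obtain ⟨b, rfl⟩ := symp_surjective hd ha c
    have hl : ∃ l, q b l ≠ 0 := by
      by_contra! h
      simpa [h] using hrow b
    obtain ⟨l, hl⟩ := hl
    exact ⟨l, (hsupp b l hl).symm⟩
  have hbij : Function.Bijective k := Finite.injective_iff_bijective.1
    (Finite.injective_iff_surjective.2 hsurj)
  have hind : ∀ b l, q b l = if symp a b = k l then 1 else 0 := by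
    intro b l
    split_ifs with h
    · rw [← hrow b, eq_comm]
      refine Finset.sum_eq_single l (fun m _ hm => ?_) (by simp)
      by_contra hne
      exact hm (hbij.1 ((hsupp b m hne).symm.trans h))
    · by_contra hne
      exact h (hsupp b l hne)
  rw [hS, ← shannon_comp_equiv (Equiv.ofBijective k hbij) (transProb p a)]
  congr 1
  funext l
  simp [hind, transProb, Finset.sum_filter]

lemma lowerBound_eq_eigenLowerBound (hd : d.Prime) (p : Idx d → ℝ) :
    lowerBound p = eigenLowerBound p := by
  rw [lowerBound, eigenLowerBound, iInf]
  congr 2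
  ext s
  constructor
  · rintro ⟨⟨a, ha⟩, rfl⟩
    obtain ⟨ψ, hψ⟩ := exists_isEigenstate a
    refine ⟨a, ha, ψ, hψ, ?_⟩
    rw [vonNeumann_eq_shannon_transProb hd p ha hψ]
    exact shannon_transMatrix p a
  · rintro ⟨a, ha, ψ, hψ, rfl⟩
    refine ⟨⟨a, ha⟩, ?_⟩
    rw [vonNeumann_eq_shannon_transProb hd p ha hψ]
    exact shannon_transMatrix p a

lemma eigenLowerBound_eq_of_sortedAchievable (hd : d.Prime) {p : Idx d → ℝ} (hp : ∀ b, 0 ≤ p b)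
    (h : SortedAchievable p) : eigenLowerBound p = upperBound p := by
  rw [eigenLowerBound_eq_upperBound_iff]
  obtain ⟨σ, hσ, a, ha, k, hk⟩ := h
  have hk' : ∀ i r, symp a (σ (finProdFinEquiv (i, r))) = k i := fun i r =>
    hk i _ (Finset.mem_image.2 ⟨r, Finset.mem_univ r, rfl⟩)
  obtain ⟨ψ, hψ⟩ := exists_isEigenstate a
  refine IsLeast.csInf_eq ⟨⟨a, ha, ψ, hψ, ?_⟩, ?_⟩
  · rw [vonNeumann_eq_shannon_transProb hd p ha hψ, zeta_eq_of_antitone hσ,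
      shannon_blockSum_eq_transProb hd p ha σ k hk']
  · rintro s ⟨a, -, ψ, hψ, rfl⟩
    exact shannon_zeta_le_vonNeumann hp hψ

/-! ### Composite dimension -/

lemma trace_pureState_mul_pureState (x y : ZMod d → ℂ) :
    (pureState x * pureState y).trace = ((‖star x ⬝ᵥ y‖ ^ 2 : ℝ) : ℂ) := by
  have h : star y ⬝ᵥ x = (starRingEnd ℂ) (star x ⬝ᵥ y) := by
    rw [← Complex.star_def, ← Matrix.star_dotProduct_star, star_star]
  rw [pureState, pureState, Matrix.mul_vecMulVec, Matrix.trace_vecMulVec, ← pureState,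
    dotProduct_comm, pureState, Matrix.vecMulVec_mulVec, op_smul_eq_smul,
    dotProduct_smul, smul_eq_mul, h, Complex.mul_conj']
  push_cast
  rfl

/-- The linear entropy `1 - Tr N(|ψ⟩⟨ψ|)²` of the output for a probability vector `p`, written as a
mixture of the defects from `1` of the fidelities of the states `W_b ψ`. -/
def impurity (p : Idx d → ℝ) (ψ : ZMod d → ℂ) : ℝ :=
  ∑ b, ∑ b', p b * p b' * (1 - ‖star (weyl b *ᵥ ψ) ⬝ᵥ (weyl b' *ᵥ ψ)‖ ^ 2)

lemma impurity_eq {p : Idx d → ℝ} (hp : IsProb p) (ψ : ZMod d → ℂ) :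
    impurity p ψ = 1 - (channel p (pureState ψ) * channel p (pureState ψ)).trace.re := by
  have h1 : ∑ b, ∑ b', p b * p b' = 1 := by rw [← Finset.sum_mul_sum, hp.2, one_mul]
  have h2 : (channel p (pureState ψ) * channel p (pureState ψ)).trace =
      ((∑ b, ∑ b', p b * p b' * ‖star (weyl b *ᵥ ψ) ⬝ᵥ (weyl b' *ᵥ ψ)‖ ^ 2 : ℝ) : ℂ) := by
    simp only [channel_pureState, Finset.sum_mul_sum, Matrix.trace_sum, Matrix.smul_mul,
      Matrix.mul_smul, Matrix.trace_smul, trace_pureState_mul_pureState, smul_eq_mul]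
    push_cast
    refine Finset.sum_congr rfl fun b _ => Finset.sum_congr rfl fun b' _ => ?_
    ring
  rw [h2, Complex.ofReal_re, ← h1, impurity, ← Finset.sum_sub_distrib]
  refine Finset.sum_congr rfl fun b _ => ?_
  rw [← Finset.sum_sub_distrib]
  exact Finset.sum_congr rfl fun b' _ => by ring

lemma continuous_impurity (p : Idx d → ℝ) : Continuous (impurity p) := by
  refine continuous_finsetSum _ fun b _ => continuous_finsetSum _ fun b' _ => ?_
  have h : ∀ b : Idx d, Continuous fun ψ : ZMod d → ℂ => weyl b *ᵥ ψ := fun b =>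
    continuous_const.matrix_mulVec continuous_id
  exact continuous_const.mul
    (continuous_const.sub ((((h b).star).dotProduct (h b')).norm.pow 2))

/-- Since `-log t ≥ 1 - t`, the von Neumann entropy is bounded below by the linear entropy. -/
lemma impurity_le_vonNeumann {p : Idx d → ℝ} (hp : IsProb p) {a : Idx d} {ψ : ZMod d → ℂ}
    (hψ : IsEigenstate a ψ) :
    (Real.log 2)⁻¹ * impurity p ψ ≤ vonNeumann (channel p (pureState ψ)) := by
  obtain ⟨q, -, hq, hrow, -, -, hS, htr⟩ := exists_overlaps p hψ
  have hlog : 0 ≤ (Real.log 2)⁻¹ := inv_nonneg.2 (Real.log_nonneg (by norm_num))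
  have hsum : ∑ l, ∑ b, p b * q b l = 1 := by
    rw [Finset.sum_comm]
    simp only [← Finset.mul_sum, hrow, mul_one, hp.2]
  rw [hS, impurity_eq hp, htr, shannon_eq_negMulLog, ← hsum, ← Finset.sum_sub_distrib]
  refine mul_le_mul_of_nonneg_left (Finset.sum_le_sum fun l _ => ?_) hlog
  have h0 : 0 ≤ ∑ b, p b * q b l := Finset.sum_nonneg fun b _ => mul_nonneg (hp.1 b) (hq b l)
  rcases h0.eq_or_lt with h | h
  · simp [← h]
  · have := mul_le_mul_of_nonneg_left (Real.log_le_sub_one_of_pos h) h.le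
    rw [Real.negMulLog]
    linarith

open scoped ComplexOrder in
lemma norm_sq_dotProduct_le_one {x y : ZMod d → ℂ} (hx : star x ⬝ᵥ x = 1) (hy : star y ⬝ᵥ y = 1) :
    ‖star x ⬝ᵥ y‖ ^ 2 ≤ 1 ∧ (‖star x ⬝ᵥ y‖ ^ 2 = 1 → y = (star x ⬝ᵥ y) • x) := by
  set c := star x ⬝ᵥ y with hc
  have hyx : star y ⬝ᵥ x = (starRingEnd ℂ) c := by
    rw [← Complex.star_def, hc, ← Matrix.star_dotProduct_star, star_star]
  have key : star (y - c • x) ⬝ᵥ (y - c • x) = ((1 - ‖c‖ ^ 2 : ℝ) : ℂ) := by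
    rw [star_sub, star_smul, sub_dotProduct, dotProduct_sub, dotProduct_sub, smul_dotProduct,
      smul_dotProduct, dotProduct_smul, dotProduct_smul, hx, hy, hyx, ← hc]
    simp only [smul_eq_mul, mul_one, Complex.star_def]
    push_cast
    rw [← Complex.mul_conj']
    ring
  constructor
  · rw [star_dotProduct_self] at key
    have h : ∑ k, ‖(y - c • x) k‖ ^ 2 = 1 - ‖c‖ ^ 2 := by exact_mod_cast key
    have : 0 ≤ ∑ k, ‖(y - c • x) k‖ ^ 2 := Finset.sum_nonneg fun _ _ => by positivity
    linarith
  · intro h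
    rw [h, sub_self, Complex.ofReal_zero, dotProduct_star_self_eq_zero] at key
    exact sub_eq_zero.1 key

/-- If the output is pure, the states `W_b ψ` with `p b ≠ 0` all coincide up to phases. -/
lemma exists_smul_of_impurity_le_zero {p : Idx d → ℝ} (hp : ∀ b, 0 ≤ p b) {ψ : ZMod d → ℂ}
    (hψ : star ψ ⬝ᵥ ψ = 1) (h : impurity p ψ ≤ 0) {b b' : Idx d} (hb : p b ≠ 0) (hb' : p b' ≠ 0) :
    ∃ c : ℂ, weyl b' *ᵥ ψ = c • (weyl b *ᵥ ψ) := by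
  have hunit : ∀ b, star (weyl b *ᵥ ψ) ⬝ᵥ (weyl b *ᵥ ψ) = 1 := fun b => by
    rw [star_mulVec_dotProduct_mulVec (conjTranspose_mul_weyl b), hψ]
  have hterm : ∀ b b', 0 ≤ p b * p b' * (1 - ‖star (weyl b *ᵥ ψ) ⬝ᵥ (weyl b' *ᵥ ψ)‖ ^ 2) :=
    fun b b' => mul_nonneg (mul_nonneg (hp b) (hp b'))
      (sub_nonneg.2 (norm_sq_dotProduct_le_one (hunit b) (hunit b')).1)
  have hle : p b * p b' * (1 - ‖star (weyl b *ᵥ ψ) ⬝ᵥ (weyl b' *ᵥ ψ)‖ ^ 2) ≤ 0 :=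
    ((Finset.single_le_sum (fun b' _ => hterm b b') (Finset.mem_univ b')).trans
      (Finset.single_le_sum (f := fun b => ∑ b', p b * p b' *
        (1 - ‖star (weyl b *ᵥ ψ) ⬝ᵥ (weyl b' *ᵥ ψ)‖ ^ 2))
        (fun b _ => Finset.sum_nonneg fun b' _ => hterm b b') (Finset.mem_univ b))).trans h
  have hz := le_antisymm hle (hterm b b')
  rcases mul_eq_zero.1 hz with h0 | h0
  · exact absurd h0 (mul_ne_zero hb hb')
  · exact ⟨_, (norm_sq_dotProduct_le_one (hunit b) (hunit b')).2 (sub_eq_zero.1 h0).symm⟩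

lemma weyl_zero_mulVec (ψ : ZMod d → ℂ) : weyl (0 : Idx d) *ᵥ ψ = ψ := by
  funext k
  simp [weyl_mulVec]

/-- A pure output would make `ψ` a common eigenvector of `W_b` and `W_{b'}`, which is impossible
since they commute only up to a phase different from `1`. -/
lemma impurity_pos {p : Idx d → ℝ} (hp : ∀ b, 0 ≤ p b) {b b' : Idx d} (h0 : p 0 ≠ 0)
    (hb : p b ≠ 0) (hb' : p b' ≠ 0) (hbb' : symp b b' ≠ 0) {ψ : ZMod d → ℂ}
    (hψ : star ψ ⬝ᵥ ψ = 1) : 0 < impurity p ψ := by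
  by_contra! hle
  obtain ⟨c, hc⟩ := exists_smul_of_impurity_le_zero hp hψ hle h0 hb
  obtain ⟨c', hc'⟩ := exists_smul_of_impurity_le_zero hp hψ hle h0 hb'
  rw [weyl_zero_mulVec] at hc hc'
  have hc0 := left_ne_zero_of_mul_eq_one (eigenvalue_mul_conj hψ hc)
  have hc0' := left_ne_zero_of_mul_eq_one (eigenvalue_mul_conj hψ hc')
  have hψ0 : ψ ≠ 0 := fun h => by simp [h] at hψ
  have h := weyl_mulVec_weyl_mulVec b b' ψ
  rw [hc, hc', Matrix.mulVec_smul, Matrix.mulVec_smul, hc, hc', smul_smul, smul_smul, smul_smul]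
    at h
  have h2 := smul_left_injective ℂ hψ0 h
  have h3 : (ZMod.stdAddChar (symp b b') : ℂ) = ZMod.stdAddChar (0 : ZMod d) := by
    rw [AddChar.map_zero_eq_one]
    refine mul_right_cancel₀ (mul_ne_zero hc0 hc0') ?_
    linear_combination -h2
  exact hbb' (ZMod.injective_stdAddChar h3)

lemma isCompact_unit_vectors : IsCompact {ψ : ZMod d → ℂ | star ψ ⬝ᵥ ψ = 1} := by
  refine Metric.isCompact_of_isClosed_isBounded ?_ ?_
  · exact isClosed_eq (continuous_star.dotProduct continuous_id) continuous_const
  · refine (Metric.isBounded_closedBall (x := (0 : ZMod d → ℂ)) (r := 1)).subset fun ψ hψ => ?_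
    rw [Set.mem_ofPred_eq, star_dotProduct_self] at hψ
    have h : ∑ k, ‖ψ k‖ ^ 2 = 1 := by exact_mod_cast hψ
    rw [mem_closedBall_zero_iff, pi_norm_le_iff_of_nonneg zero_le_one]
    intro k
    have := Finset.single_le_sum (f := fun k => ‖ψ k‖ ^ 2) (fun _ _ => by positivity)
      (Finset.mem_univ k)
    rw [h] at this
    exact (sq_le_one_iff₀ (norm_nonneg _)).1 this

/-- If `p` charges `0` and two index pairs of noncommuting Weyl operators, the output entropies are
bounded away from zero. -/
lemma sInf_eigenEntropies_pos (hd : 1 < d) {p : Idx d → ℝ} (hp : IsProb p) {b b' : Idx d}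
    (h0 : p 0 ≠ 0) (hb : p b ≠ 0) (hb' : p b' ≠ 0) (hbb' : symp b b' ≠ 0) :
    0 < sInf (eigenEntropies p) := by
  obtain ⟨ψ₀, hψ₀⟩ := exists_isEigenstate (0 : Idx d)
  obtain ⟨φ, hφ, hmin⟩ := isCompact_unit_vectors.exists_isMinOn ⟨ψ₀, hψ₀.1⟩
    (continuous_impurity p).continuousOn
  have hlog : 0 < (Real.log 2)⁻¹ := inv_pos.2 (Real.log_pos (by norm_num))
  refine (mul_pos hlog (impurity_pos hp.1 h0 hb hb' hbb' hφ)).trans_le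
    (le_csInf (eigenEntropies_nonempty hd p) ?_)
  rintro s ⟨a, -, ψ, hψ, rfl⟩
  exact (mul_le_mul_of_nonneg_left (isMinOn_iff.1 hmin ψ hψ.1) hlog.le).trans
    (impurity_le_vonNeumann hp hψ)

/-- The uniform distribution on the index pairs `(0, 0)`, `(0, 1)` and `(c, 0)`, for `c ≠ 0`. -/
def threePoint (c : ZMod d) (b : Idx d) : ℝ :=
  (if b = 0 then 1 / 3 else 0) + (if b = (0, 1) then 1 / 3 else 0) +
    (if b = (c, 0) then 1 / 3 else 0)

lemma threePoint_nonneg (c : ZMod d) (b : Idx d) : 0 ≤ threePoint c b := by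
  unfold threePoint
  positivity

lemma sum_threePoint (c : ZMod d) : ∑ b, threePoint c b = 1 := by
  simp only [threePoint, Finset.sum_add_distrib, Finset.sum_ite_eq', Finset.mem_univ, if_true]
  norm_num

/-- If `s * c = 0` in `ZMod d`, the three index pairs of `threePoint c` lie in the same fibre of the
symplectic form of `(0, s)`. Exchanging `(c, 0)` with `(0, -1)` brings them into the block
`{(0, y)}` without leaving that fibre. -/
lemma exists_arrangement_threePoint (hd : 2 < d) {s c : ZMod d} (hsc : s * c = 0) (hc : c ≠ 0) :
    ∃ (σ : Fin (d * d) ≃ Idx d) (k : Fin d → ZMod d),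
      (∀ i r, symp (0, s) (σ (finProdFinEquiv (i, r))) = k i) ∧
      ∀ i r, threePoint c (σ (finProdFinEquiv (i, r))) ≠ 0 → i.val = 0 := by
  obtain ⟨e, he⟩ := exists_finEquivZMod d
  have := Fact.mk (show 1 < d by omega)
  have := Fact.mk hd
  have h11 : (1 : ZMod d) ≠ -1 := (ZMod.neg_one_ne_one (n := d)).symm
  set w : Equiv.Perm (Idx d) := Equiv.swap (c, 0) (0, -1) with hw
  have hsymp : ∀ b, symp (0, s) (w b) = s * b.1 := by
    intro b
    by_cases h1 : b = (c, 0)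
    · rw [h1, hw, Equiv.swap_apply_left]
      simp [symp, hsc]
    · by_cases h2 : b = (0, -1)
      · rw [h2, hw, Equiv.swap_apply_right]
        simp [symp, hsc]
      · rw [hw, Equiv.swap_apply_of_ne_of_ne h1 h2]
        simp [symp]
  have hsupp : ∀ b, threePoint c (w b) ≠ 0 → b.1 = 0 := by
    intro b hb
    have h : w b = 0 ∨ w b = (0, 1) ∨ w b = (c, 0) := by
      by_contra! h
      simp [threePoint, h] at hb
    rcases h with h | h | h
    · rw [hw, Equiv.swap_apply_eq_iff, Equiv.swap_apply_of_ne_of_ne] at h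
      · rw [h]; rfl
      · exact fun h' => hc (congrArg Prod.fst h').symm
      · exact fun h' => by simpa using congrArg Prod.snd h'
    · rw [hw, Equiv.swap_apply_eq_iff, Equiv.swap_apply_of_ne_of_ne] at h
      · rw [h]
      · exact fun h' => hc (congrArg Prod.fst h').symm
      · exact fun h' => h11 (congrArg Prod.snd h')
    · rw [hw, Equiv.swap_apply_eq_iff, Equiv.swap_apply_left] at h
      rw [h]
  refine ⟨finProdFinEquiv.symm.trans ((Equiv.prodCongr e e).trans w), fun i => s * e i,
    fun i r => ?_, fun i r h => ?_⟩
  · simp [hsymp]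
  · have h0 : e i = 0 := by simpa using hsupp (e i, e r) (by simpa using h)
    rw [he] at h0
    have := congrArg ZMod.val h0
    rwa [ZMod.val_natCast, Nat.mod_eq_of_lt i.isLt, ZMod.val_zero] at this

lemma shannon_eq_zero_of_concentrated {ι : Type} [Fintype ι] {v : ι → ℝ} (i : ι)
    (h : ∀ j, j ≠ i → v j = 0) (h1 : ∑ j, v j = 1) : shannon v = 0 := by
  have hi : v i = 1 := by
    rw [← h1, eq_comm]
    exact Finset.sum_eq_single i (fun j _ hj => h j hj) (by simp)
  rw [shannon, neg_eq_zero]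
  refine Finset.sum_eq_zero fun j _ => ?_
  by_cases hj : j = i
  · rw [hj, hi, Real.logb_one, mul_zero]
  · rw [h j hj, zero_mul]

/-- With `d = m * n`, the distribution `threePoint m` is sorted achievable through the block values of
`symp (0, n)`, and its `ζ` is a point mass. -/
lemma exists_sortedAchievable_eigenLowerBound_ne (hd : 1 < d) (hd' : ¬ d.Prime) :
    ∃ p : Idx d → ℝ, IsProb p ∧ SortedAchievable p ∧ eigenLowerBound p ≠ upperBound p := by
  obtain ⟨m, ⟨n, hmn⟩, hm1, hmd⟩ := Nat.exists_dvd_of_not_prime2 hd hd'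
  have hn0 : 0 < n := by
    rcases Nat.eq_zero_or_pos n with rfl | h
    · omega
    · exact h
  have hnd : n < d := by rw [hmn]; nlinarith
  have hne : ∀ x : ℕ, 0 < x → x < d → (x : ZMod d) ≠ 0 := fun x h0 hx h =>
    absurd (Nat.le_of_dvd h0 ((ZMod.natCast_eq_zero_iff _ _).1 h)) (not_le.2 hx)
  have hc : (m : ZMod d) ≠ 0 := hne m (by omega) hmd
  have hsc : (n : ZMod d) * m = 0 := by
    rw [← Nat.cast_mul, mul_comm, ← hmn, ZMod.natCast_self]
  have ha : ((0, (n : ZMod d)) : Idx d) ≠ 0 := fun h => hne n hn0 hnd (congrArg Prod.snd h)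
  set p := threePoint (m : ZMod d) with hp
  have hprob : IsProb p := ⟨threePoint_nonneg _, sum_threePoint _⟩
  obtain ⟨σ, k, hk, hσ⟩ := exists_arrangement_threePoint (by omega) hsc hc
  have hpos : ∀ b : Idx d, b = 0 ∨ b = (0, 1) ∨ b = ((m : ZMod d), 0) → p b ≠ 0 := by
    intro b hb
    refine ne_of_gt ?_
    rw [hp, threePoint]
    rcases hb with hb | hb | hb <;> rw [if_pos hb] <;> positivity
  refine ⟨p, hprob, sortedAchievable_of_blocks ha σ k hk fun i j r s hlt => ?_, ?_⟩
  · have := hσ j s ((hprob.1 _).trans_lt hlt).ne'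
    rw [Fin.le_def]
    omega
  · rw [Ne, eigenLowerBound_eq_upperBound_iff]
    have hz : shannon (zeta p) ≤ 0 := by
      refine (shannon_zeta_le hprob.1 σ).trans_eq
        (shannon_eq_zero_of_concentrated ⟨0, by omega⟩ (fun i hi => ?_) ?_)
      · refine Finset.sum_eq_zero fun r _ => ?_
        by_contra h
        exact hi (Fin.ext (hσ i r h))
      · rw [sum_blockSum, hprob.2]
    refine (hz.trans_lt (sInf_eigenEntropies_pos hd hprob (b := (0, 1)) (b' := ((m : ZMod d), 0))
      (hpos _ (by simp)) (hpos _ (by simp)) (hpos _ (by simp)) ?_)).ne'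
    simpa [symp] using hc

end

end WeylChannel

theorem theorem3 (d : ℕ) [NeZero d] :
    (d.Prime → ∀ p : WeylChannel.Idx d → ℝ, WeylChannel.IsProb p →
      (WeylChannel.lowerBound p = WeylChannel.upperBound p ↔ WeylChannel.SortedAchievable p) ∧
      (WeylChannel.eigenLowerBound p = WeylChannel.upperBound p ↔
        WeylChannel.SortedAchievable p)) ∧
    (1 < d → ¬ d.Prime →
      (∀ p : WeylChannel.Idx d → ℝ, WeylChannel.IsProb p →
        WeylChannel.eigenLowerBound p = WeylChannel.upperBound p →
          WeylChannel.SortedAchievable p) ∧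
      (∃ p : WeylChannel.Idx d → ℝ, WeylChannel.IsProb p ∧
        WeylChannel.SortedAchievable p ∧
          WeylChannel.eigenLowerBound p ≠ WeylChannel.upperBound p)) := by
  refine ⟨fun hd p hp => ?_, fun hd hd' =>
    ⟨fun p hp => WeylChannel.sortedAchievable_of_eigenLowerBound_eq hd hp.1,
      WeylChannel.exists_sortedAchievable_eigenLowerBound_ne hd hd'⟩⟩
  have h : WeylChannel.eigenLowerBound p = WeylChannel.upperBound p ↔
      WeylChannel.SortedAchievable p :=
    ⟨WeylChannel.sortedAchievable_of_eigenLowerBound_eq hd.one_lt hp.1,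
      WeylChannel.eigenLowerBound_eq_of_sortedAchievable hd hp.1⟩
  exact ⟨by rw [WeylChannel.lowerBound_eq_eigenLowerBound hd, h], h⟩
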